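/- Let $n,p_c,p_d,q_c,q_d\in\mathbb Z_{\ge 0}$ and consider the impulsive system with constant delays $h_c>0$, $h_d\in\mathbb Z_{\ge0}$ $$\begin{aligned} \dot x(t_k+\tau)&=A(\tau)x(t_k+\tau)+G_c(\tau)x(t_k+\tau-h_c)+E_c(\tau)w_c(t_k+\tau),\\ z_c(t_k+\tau)&=C_cx(t_k+\tau)+H_cx(t_k+\tau-h_c)+F_cw_c(t_k+\tau),&&\tau\in(0,T_k],\ k\ge0,\\ x(t_k^+)&=Jx(t_k)+G_dx(t_{k-h_d})+E_dw_d(k),\\ z_d(k)&=C_dx(t_k)+H_dx(t_{k-h_d})+F_dw_d(k),&&k\ge1, \end{aligned}$$ with left-continuous state $x\in\mathbb R^n$, inputs $w_c\in\mathbb R^{p_c}$, $w_d\in\mathbb R^{p_d}$ and outputs $z_c\in\mathbb R^{q_c}$, $z_d\in\mathbb R^{q_d}$. Here $0=t_0<t_1<\cdots$, $t_k\to\infty$, $T_k=t_{k+1}-t_k$; the functions $A,G_c,E_c$ are continuous on $[0,\infty)$ and the other matrices are constant. The initial data are $x=\phi_0\in C([-h_c,0],\mathbb R^n)$ on $[-h_c,0]$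 (with $x(0^+)=x(0)$) together with an arbitrary finite discrete history $\psi_k\in\mathbb R^n$, used as the value of $x(t_{k-h_d})$ when $k<h_d$; $\|(\phi_0,\psi)\|$ is the maximum of their sup-norms. Solutions are understood in the integral (Carathéodory) sense. The system is *internally positive* if, for all delays and all impulse sequences as above, componentwise nonnegative $\phi_0,\psi,w_c,w_d$ (with $w_c$ locally integrable) imply $x(t)\ge0$ for $t\ge0$, $z_c(t)\ge0$ for $t>0$ and $z_d(k)\ge0$ for $k\ge1$. **Theorem.** Let $\bar T>0$. Assume that the system is internally positive and that $A,G_c,E_c$ are constant on $[\bar T,\infty)$. Assume that there exist a differentiable $\zeta:[0,\bar T]\to\mathbb R^n$ with $\zeta(0)>0$ and $\zeta(\bar T)>0$ componentwise, a constant vector $\mu_c\in\mathbb R^n_{>0}$ and scalars $\epsilon,\gamma>0$ such that, componentwise and with $\mathbf 1$ the vector of ones, (MinDT0) $\zeta(\bar T)^TA(\bar T)+\mu_c^T+\mathbf 1^TC_c\le-\epsilon\mathbf 1^T$, $\ \zeta(\bar T)^TG_c(\bar T)-\mu_c^T+\mathbf 1^TH_c\le0$, $\ \zeta(\bar T)^TE_c(\bar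 T)+\mathbf 1^TF_c\le\gamma\mathbf 1^T$; (MinDT1) for all $\tau\in[0,\bar T]$: $\dot\zeta(\tau)^T+\zeta(\tau)^TA(\tau)+\mu_c^T+\mathbf 1^TC_c\le0$, $\ \zeta(\tau)^TG_c(\tau)-\mu_c^T+\mathbf 1^TH_c\le0$, $\ \zeta(\tau)^TE_c(\tau)+\mathbf 1^TF_c\le\gamma\mathbf 1^T$; (MinDT2) $-\zeta(\bar T)^T+\zeta(0)^T(J+G_d)+\mathbf 1^T(C_d+H_d)\le-\epsilon\mathbf 1^T$, $\ \zeta(0)^TE_d+\mathbf 1^TF_d\le\gamma\mathbf 1^T$. Then, for all delays $h_c>0$ and $h_d\in\mathbb Z_{\ge0}$: 1. The system is asymptotically stable under the minimum dwell-time condition $T_k\ge\bar T$ for all $k\ge 0$. That is, with $w_c=0$ and $w_d=0$: for every $\eta>0$ there is $\delta>0$ such that, for every admissible impulse sequence, $\|(\phi_0,\psi)\|<\delta$ implies $\|x(t)\|<\eta$ for all $t\ge0$; and, for every admissible impulse sequence and all initial data, $x(t)\to0$ as $t\to\infty$. 2. The map $(w_c,w_d)\mapsto(z_c,z_d)$ has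 hybrid $L_1/\ell_1$-gain at most $\gamma$ under the same dwell-time condition. That is, there is an increasing function $v:[0,\infty)\to[0,\infty)$ with $v(0)=0$ and $v(s)\to\infty$ as $s\to\infty$ such that, for all impulse sequences with $T_k\ge\bar T$, all initial data, all $w_c\in L_1$ and all $w_d\in\ell_1$, one has $z_c\in L_1$, $z_d\in\ell_1$ and $$\|z_c\|_{L_1}+\|z_d\|_{\ell_1}\le\gamma\left(\|w_c\|_{L_1}+\|w_d\|_{\ell_1}\right)+v(\|(\phi_0,\psi)\|),$$ where $\|f\|_{L_1}=\int_0^\infty\sum_i|f_i(t)|\,dt$ and $\|g\|_{\ell_1}=\sum_{k\ge1}\sum_i|g_i(k)|$. -/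

import Mathlib

open Set Filter Topology MeasureTheory
open scoped Matrix

/-- The matrices of a timer-dependent linear impulsive system with delays.  The continuous-time
matrices `A`, `Gc`, `Ec` are continuous functions of the timer `τ ≥ 0`. -/
structure ImpulsiveDelaySystem (n pc pd qc qd : ℕ) where
  A : ℝ → Matrix (Fin n) (Fin n) ℝ
  Gc : ℝ → Matrix (Fin n) (Fin n) ℝ
  Ec : ℝ → Matrix (Fin n) (Fin pc) ℝ
  Cc : Matrix (Fin qc) (Fin n) ℝ
  Hc : Matrix (Fin qc) (Fin n) ℝ
  Fc : Matrix (Fin qc) (Fin pc) ℝ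
  J : Matrix (Fin n) (Fin n) ℝ
  Gd : Matrix (Fin n) (Fin n) ℝ
  Ed : Matrix (Fin n) (Fin pd) ℝ
  Cd : Matrix (Fin qd) (Fin n) ℝ
  Hd : Matrix (Fin qd) (Fin n) ℝ
  Fd : Matrix (Fin qd) (Fin pd) ℝ
  continuousOn_A : ContinuousOn A (Ici 0)
  continuousOn_Gc : ContinuousOn Gc (Ici 0)
  continuousOn_Ec : ContinuousOn Ec (Ici 0)

/-- Impulse times `0 = t 0 < t 1 < t 2 < ...` tending to infinity (there is no jump at `t 0`). -/
structure IsImpulseSequence (t : ℕ → ℝ) : Prop where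
  zero : t 0 = 0
  lt_succ : ∀ k, t k < t (k + 1)
  tendsto : Tendsto t atTop atTop

/-- The minimum dwell-time condition: every dwell time `t (k + 1) - t k` is at least `Tbar`. -/
def HasMinDwellTime (Tbar : ℝ) (t : ℕ → ℝ) : Prop :=
  ∀ k, Tbar ≤ t (k + 1) - t k

/-- The `1`-norm of a vector. -/
def vecL1 {m : ℕ} (v : Fin m → ℝ) : ℝ := ∑ i, |v i|

/-- The delayed sample `x (t (k - hd))` entering the `k`-th jump.  For `k < hd` the index is
negative and the sample is the prescribed discrete history value `ψ k`. -/
def delayedSample {n : ℕ} (hd : ℕ) (t : ℕ → ℝ) (ψ : Fin hd → Fin n → ℝ) (x : ℝ → Fin n → ℝ)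
    (k : ℕ) : Fin n → ℝ :=
  if h : k < hd then ψ ⟨k, h⟩ else x (t (k - hd))

namespace ImpulsiveDelaySystem

variable {n pc pd qc qd : ℕ} (S : ImpulsiveDelaySystem n pc pd qc qd)

/-- The right-hand side of the flow equation at timer value `τ` in the interval starting
at `tk`. -/
def flowField (hc tk : ℝ) (wc : ℝ → Fin pc → ℝ) (x : ℝ → Fin n → ℝ) (τ : ℝ) : Fin n → ℝ :=
  S.A τ *ᵥ x (tk + τ) + S.Gc τ *ᵥ x (tk + τ - hc) + S.Ec τ *ᵥ wc (tk + τ)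

/-- The right limit of the state at `t k`: the jump map for `k ≥ 1`, and `x 0` for `k = 0`. -/
def postJump (hd : ℕ) (t : ℕ → ℝ) (ψ : Fin hd → Fin n → ℝ) (wd : ℕ → Fin pd → ℝ)
    (x : ℝ → Fin n → ℝ) (k : ℕ) : Fin n → ℝ :=
  if k = 0 then x 0
  else S.J *ᵥ x (t k) + S.Gd *ᵥ delayedSample hd t ψ x k + S.Ed *ᵥ wd k

/-- `x` is a (left-continuous, Carathéodory) solution of the impulsive system with delays
`hc`, `hd`, impulse times `t`, initial function `φ` on `[-hc, 0]`, discrete history `ψ` and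
inputs `wc`, `wd`.  The value `x (t k)` is the state just before the `k`-th jump. -/
structure IsSolution (hc : ℝ) (hd : ℕ) (t : ℕ → ℝ)
    (φ : C(Icc (-hc) (0 : ℝ), Fin n → ℝ)) (ψ : Fin hd → Fin n → ℝ)
    (wc : ℝ → Fin pc → ℝ) (wd : ℕ → Fin pd → ℝ) (x : ℝ → Fin n → ℝ) : Prop where
  history : ∀ s : Icc (-hc) (0 : ℝ), x s = φ s
  integrable : ∀ k, IntervalIntegrable (S.flowField hc (t k) wc x) volume 0 (t (k + 1) - t k)
  flow : ∀ k, ∀ τ ∈ Ioc 0 (t (k + 1) - t k),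
    x (t k + τ) = S.postJump hd t ψ wd x k + ∫ s in (0 : ℝ)..τ, S.flowField hc (t k) wc x s

/-- The continuous-time performance output at time `s > 0`. -/
def zc (hc : ℝ) (wc : ℝ → Fin pc → ℝ) (x : ℝ → Fin n → ℝ) (s : ℝ) : Fin qc → ℝ :=
  S.Cc *ᵥ x s + S.Hc *ᵥ x (s - hc) + S.Fc *ᵥ wc s

/-- The discrete-time performance output at the `k`-th jump, `k ≥ 1`. -/
def zd (hd : ℕ) (t : ℕ → ℝ) (ψ : Fin hd → Fin n → ℝ) (wd : ℕ → Fin pd → ℝ)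
    (x : ℝ → Fin n → ℝ) (k : ℕ) : Fin qd → ℝ :=
  S.Cd *ᵥ x (t k) + S.Hd *ᵥ delayedSample hd t ψ x k + S.Fd *ᵥ wd k

/-- Internal positivity: nonnegative initial data and inputs produce a nonnegative state and
nonnegative outputs, whatever the delays and the impulse times. -/
def InternallyPositive : Prop :=
  ∀ (hc : ℝ) (hd : ℕ) (t : ℕ → ℝ), 0 < hc → IsImpulseSequence t →
  ∀ (φ : C(Icc (-hc) (0 : ℝ), Fin n → ℝ)) (ψ : Fin hd → Fin n → ℝ)
    (wc : ℝ → Fin pc → ℝ) (wd : ℕ → Fin pd → ℝ) (x : ℝ → Fin n → ℝ),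
    (∀ s, 0 ≤ φ s) → (∀ j, 0 ≤ ψ j) →
    LocallyIntegrableOn wc (Ici 0) → (∀ s, 0 ≤ s → 0 ≤ wc s) → (∀ k, 1 ≤ k → 0 ≤ wd k) →
    S.IsSolution hc hd t φ ψ wc wd x →
    (∀ s, 0 ≤ s → 0 ≤ x s) ∧ (∀ s, 0 < s → 0 ≤ S.zc hc wc x s) ∧
      ∀ k, 1 ≤ k → 0 ≤ S.zd hd t ψ wd x k

/-- Asymptotic stability of the system without inputs under the minimum dwell-time `Tbar`:
Lyapunov stability, uniformly over the admissible impulse sequences, and convergence to zero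
of every solution for every admissible impulse sequence. -/
def AsymptoticallyStable (hc : ℝ) (hd : ℕ) (Tbar : ℝ) : Prop :=
  (∀ ε : ℝ, 0 < ε → ∃ δ : ℝ, 0 < δ ∧
    ∀ t : ℕ → ℝ, IsImpulseSequence t → HasMinDwellTime Tbar t →
    ∀ (φ : C(Icc (-hc) (0 : ℝ), Fin n → ℝ)) (ψ : Fin hd → Fin n → ℝ) (x : ℝ → Fin n → ℝ),
      S.IsSolution hc hd t φ ψ 0 0 x → ‖(φ, ψ)‖ < δ → ∀ s, 0 ≤ s → ‖x s‖ < ε) ∧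
  (∀ t : ℕ → ℝ, IsImpulseSequence t → HasMinDwellTime Tbar t →
    ∀ (φ : C(Icc (-hc) (0 : ℝ), Fin n → ℝ)) (ψ : Fin hd → Fin n → ℝ) (x : ℝ → Fin n → ℝ),
      S.IsSolution hc hd t φ ψ 0 0 x → Tendsto x atTop (𝓝 0))

/-- The map `(wc, wd) ↦ (zc, zd)` has hybrid `L1`/`l1`-gain at most `γ` under the minimum
dwell-time `Tbar`.  The function `v` is the same for all inputs, initial data and admissible
impulse sequences; the outputs are integrable, respectively summable. -/
def HasHybridGain (hc : ℝ) (hd : ℕ) (Tbar γ : ℝ) : Prop :=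
  ∃ v : ℝ → ℝ, StrictMonoOn v (Ici 0) ∧ v 0 = 0 ∧ Tendsto v atTop atTop ∧
    ∀ t : ℕ → ℝ, IsImpulseSequence t → HasMinDwellTime Tbar t →
    ∀ (φ : C(Icc (-hc) (0 : ℝ), Fin n → ℝ)) (ψ : Fin hd → Fin n → ℝ)
      (wc : ℝ → Fin pc → ℝ) (wd : ℕ → Fin pd → ℝ) (x : ℝ → Fin n → ℝ),
      IntegrableOn wc (Ioi 0) → Summable (fun k => vecL1 (wd (k + 1))) →
      S.IsSolution hc hd t φ ψ wc wd x →
      IntegrableOn (S.zc hc wc x) (Ioi 0) ∧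
      Summable (fun k => vecL1 (S.zd hd t ψ wd x (k + 1))) ∧
      (∫ s in Ioi 0, vecL1 (S.zc hc wc x s)) + ∑' k, vecL1 (S.zd hd t ψ wd x (k + 1)) ≤
        γ * ((∫ s in Ioi 0, vecL1 (wc s)) + ∑' k, vecL1 (wd (k + 1))) + v ‖(φ, ψ)‖

end ImpulsiveDelaySystem

/-!
Both claims follow from one dissipation inequality for a linear copositive Lyapunov functional.
Along a nonnegative solution, with timer value `τ = s - t k` and `p` the costate `ζ` on
`[0, Tbar]`, constant afterwards, the functional

  `p τ ⬝ᵥ x s + ∫ r in (s - hc)..s, μ ⬝ᵥ x r + ∑ (stored samples), (p 0 ᵥ* Gd + 1 ᵥ* Hd) ⬝ᵥ x (t j)`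

decreases during flows and at jumps by at least the sum of the outputs minus `γ` times the sum of
the inputs (`IsSolution.flow_dissipation`, `IsCertificate.jump_dissipation`,
`IsSolution.total_dissipation`). The state is only absolutely continuous and the derivative of `ζ`
need not be continuous; since that derivative is bounded above by a continuous function, it is
integrable, and the product rule for absolutely continuous functions applies
(`mul_sub_mul_le_integral`). The dwell-time condition guarantees that the timer reaches `Tbar`
before every jump, so that evaluating the functional at the impulse times only involves `ζ 0` and
`ζ Tbar`. The functional is nonnegative because the matrices `Gd` and `Hd` are nonnegative, which
internal positivity forces (`InternallyPositive.nonneg_Gd_Hd`).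

Arbitrary data are reduced to nonnegative data by linearity: if `X` solves the system for the
absolute values of the data, then `X + x` and `X - x` have nonnegative data, so internal positivity
bounds `|x|` and the absolute values of the outputs by `X` and its outputs
(`InternallyPositive.exists_majorant`). This requires the existence of solutions for all data
(`exists_isSolution`), obtained interval by interval from a Volterra equation with delay. The gain
bound is then the dissipation inequality for `X` (`IsCertificate.hasHybridGain`).

For stability the flow inequality on `[0, Tbar]` has no slack, whereas the inequalities at `Tbar`
and at the jumps do. Subtracting from `ζ` a small multiple of a function that vanishes at `0` and
grows fast enough spreads this slack over the whole timer interval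
(`IsCertificate.exists_pos_slack`); the delayed inequality survives because internal positivity
also forces `Gc τ` to be nonnegative (`InternallyPositive.nonneg_Gc`). With positive slack, `‖x‖` is
integrable in time and summable over the impulse times, with bounds proportional to the size of the
initial data. The integral form of the flow equation turns this into pointwise bounds and
convergence (`IsCertificate.asymptoticallyStable`).
-/

/-! ### Absolutely continuous functions, Grönwall bounds and Volterra equations with delay -/

/-- An inequality form of the product rule on an interval for a differentiable `p` and an absolutely
continuous `ξ ≥ 0`. Only an upper bound `g` of the derivative of `p` enters, so no integrability of
that derivative has to be assumed. -/
theorem mul_sub_mul_le_integral {a b : ℝ} (hab : a ≤ b) {p p' g f ξ : ℝ → ℝ}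
    (hp : ∀ τ ∈ Icc a b, HasDerivWithinAt p (p' τ) (Icc a b) τ)
    (hg : ContinuousOn g (Icc a b)) (hpg : ∀ τ ∈ Icc a b, p' τ ≤ g τ)
    (hf : IntervalIntegrable f volume a b)
    (hξ : ∀ τ ∈ Icc a b, ξ τ = ξ a + ∫ s in a..τ, f s)
    (hξ0 : ∀ τ ∈ Icc a b, 0 ≤ ξ τ) :
    p b * ξ b - p a * ξ a ≤ ∫ τ in a..b, (g τ * ξ τ + p τ * f τ) := by
  have hu : uIcc a b = Icc a b := uIcc_of_le hab
  have hpc : ContinuousOn p (Icc a b) := fun τ hτ => (hp τ hτ).continuousWithinAt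
  have hd : ∀ τ ∈ Ioo a b, HasDerivAt p (p' τ) τ := fun τ hτ =>
    (hp τ (Ioo_subset_Icc_self hτ)).hasDerivAt (Icc_mem_nhds hτ.1 hτ.2)
  have hgi : IntervalIntegrable g volume a b := (hu ▸ hg).intervalIntegrable
  -- `∫ g - p` is monotone, so its derivative `g - p'` is integrable, and hence so is `p'`.
  have hp'i : IntervalIntegrable p' volume a b := by
    have hG : ∀ τ ∈ Ioo a b, HasDerivAt (fun τ => (∫ s in a..τ, g s) - p τ) (g τ - p' τ) τ := by
      intro τ hτ
      have hτ' : Icc a b ∈ 𝓝 τ := Icc_mem_nhds hτ.1 hτ.2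
      refine HasDerivAt.sub ?_ (hd τ hτ)
      refine intervalIntegral.integral_hasDerivAt_right
        (hgi.mono_set (by rw [uIcc_of_le hτ.1.le, hu]; exact Icc_subset_Icc_right hτ.2.le)) ?_
        (hg.continuousAt hτ')
      exact (hg.mono Ioo_subset_Icc_self).stronglyMeasurableAtFilter isOpen_Ioo τ hτ
    have h1 : IntervalIntegrable (fun τ => g τ - p' τ) volume a b := by
      refine intervalIntegral.intervalIntegrable_deriv_of_nonneg
        (g := fun τ => (∫ s in a..τ, g s) - p τ) ?_ ?_ ?_
      · rw [hu]
        refine ContinuousOn.sub ?_ hpc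
        have := intervalIntegral.continuousOn_primitive_interval' hgi left_mem_uIcc
        rwa [hu] at this
      · simpa [min_eq_left hab, max_eq_right hab] using hG
      · intro τ hτ
        rw [min_eq_left hab, max_eq_right hab] at hτ
        exact sub_nonneg.2 (hpg τ (Ioo_subset_Icc_self hτ))
    simpa using hgi.sub h1
  have hpint : ∀ τ ∈ Icc a b, p τ = p a + ∫ s in a..τ, p' s := by
    intro τ hτ
    have := intervalIntegral.integral_eq_sub_of_hasDerivAt_of_le hτ.1
      (hpc.mono (Icc_subset_Icc_right hτ.2))
      (fun s hs => hd s ⟨hs.1, hs.2.trans_le hτ.2⟩)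
      (hp'i.mono_set (by rw [uIcc_of_le hτ.1, hu]; exact Icc_subset_Icc_right hτ.2))
    linarith
  set P : ℝ → ℝ := fun τ => p a + ∫ s in a..τ, p' s with hP
  set X : ℝ → ℝ := fun τ => ξ a + ∫ s in a..τ, f s with hX
  have hconst : ∀ c : ℝ, AbsolutelyContinuousOnInterval (fun _ : ℝ => c) a b := fun c =>
    (contDiff_const.contDiffOn : ContDiffOn ℝ 1 (fun _ : ℝ => c) (uIcc a b))
      |>.absolutelyContinuousOnInterval
  have hPac : AbsolutelyContinuousOnInterval P a b :=
    (hconst _).add (hp'i.absolutelyContinuousOnInterval_intervalIntegral left_mem_uIcc)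
  have hXac : AbsolutelyContinuousOnInterval X a b :=
    (hconst _).add (hf.absolutelyContinuousOnInterval_intervalIntegral left_mem_uIcc)
  have hXc : ContinuousOn X (uIcc a b) := hXac.continuousOn
  have key := hPac.integral_deriv_mul_eq_sub hXac
  rw [hpint b ⟨hab, le_rfl⟩, hξ b ⟨hab, le_rfl⟩]
  have e1 : p a * ξ a = P a * X a := by simp [hP, hX]
  rw [e1]
  change P b * X b - P a * X a ≤ _
  rw [← key]
  refine intervalIntegral.integral_mono_ae_restrict hab ?_ ?_ ?_
  · exact (hPac.intervalIntegrable_deriv.mul_continuousOn hXc).add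
      (hXac.intervalIntegrable_deriv.continuousOn_mul hPac.continuousOn)
  · refine (hgi.mul_continuousOn ?_).add (hf.continuousOn_mul (hu ▸ hpc))
    exact hXc.congr fun τ hτ => hξ τ (hu ▸ hτ)
  · rw [Filter.EventuallyLE, ae_restrict_iff' measurableSet_Icc]
    have ha : ∀ᵐ x : ℝ, x ≠ a := by simp [ae_iff, measure_singleton]
    have hb : ∀ᵐ x : ℝ, x ≠ b := by simp [ae_iff, measure_singleton]
    filter_upwards [hf.ae_hasDerivAt_integral, ha, hb] with τ hτf hτa hτb hτ
    have hτo : τ ∈ Ioo a b := ⟨lt_of_le_of_ne hτ.1 hτa.symm, lt_of_le_of_ne hτ.2 hτb⟩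
    have d1 : deriv P τ = p' τ := by
      have : P =ᶠ[𝓝 τ] p := by
        filter_upwards [Icc_mem_nhds hτo.1 hτo.2] with s hs using (hpint s hs).symm
      rw [this.deriv_eq, (hd τ hτo).deriv]
    have d2 : deriv X τ = f τ := ((hτf (hu ▸ hτ) a left_mem_uIcc).const_add (ξ a)).deriv
    rw [d1, d2, show X τ = ξ τ from (hξ τ hτ).symm, show P τ = p τ from (hpint τ hτ).symm]
    have := mul_le_mul_of_nonneg_right (hpg τ hτ) (hξ0 τ hτ)
    linarith

/-- Grönwall's inequality in integral form. -/
theorem norm_le_mul_exp_of_norm_le_integral {E : Type*} [NormedAddCommGroup E] {y : ℝ → E}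
    {T K b : ℝ} (hK : 0 ≤ K) (hy : ContinuousOn y (Icc 0 T))
    (h : ∀ τ ∈ Icc 0 T, ‖y τ‖ ≤ b + K * ∫ s in (0 : ℝ)..τ, ‖y s‖) :
    ∀ τ ∈ Icc 0 T, ‖y τ‖ ≤ b * Real.exp (K * τ) := by
  intro τ hτ
  have h0T : (0 : ℝ) ≤ T := hτ.1.trans hτ.2
  set Y : ℝ → ℝ := fun s => ‖y (projIcc 0 T h0T s)‖ with hY
  have hYc : Continuous Y :=
    continuous_norm.comp (hy.domRestrict.comp continuous_projIcc)
  have hYy : ∀ s ∈ Icc 0 T, Y s = ‖y s‖ := fun s hs => by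
    simp only [hY, projIcc_of_mem h0T hs]
  -- The differential form of the inequality applies to the primitive `F` of the norm.
  set F : ℝ → ℝ := fun t => ∫ s in (0 : ℝ)..t, Y s with hF
  have hFd : ∀ t, HasDerivAt F (Y t) t := fun t => hYc.integral_hasStrictDerivAt 0 t |>.hasDerivAt
  have hFe : ∀ t ∈ Icc 0 T, F t = ∫ s in (0 : ℝ)..t, ‖y s‖ := by
    intro t ht
    refine intervalIntegral.integral_congr fun s hs => ?_
    rw [uIcc_of_le ht.1] at hs
    exact hYy s ⟨hs.1, hs.2.trans ht.2⟩
  have hb : ∀ t ∈ Icc 0 T, Y t ≤ K * F t + b := fun t ht => by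
    rw [hYy t ht, hFe t ht]; linarith [h t ht]
  have hg := le_gronwallBound_of_liminf_deriv_right_le (f := F) (f' := Y) (δ := 0) (K := K)
    (ε := b) (a := 0) (b := T) (fun t _ => (hFd t).continuousAt.continuousWithinAt)
    (fun t _ r hr => (hFd t).hasDerivWithinAt.liminf_right_slope_le hr) (by simp [hF])
    (fun t ht => hb t (Ico_subset_Icc_self ht)) τ hτ
  have h2 := hb τ hτ
  rw [hYy τ hτ] at h2
  rw [sub_zero] at hg
  by_cases hK0 : K = 0
  · subst hK0; simpa using h2
  · rw [gronwallBound_of_K_ne_0 hK0] at hg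
    have := mul_le_mul_of_nonneg_left hg hK
    have e : K * (0 * Real.exp (K * τ) + b / K * (Real.exp (K * τ) - 1))
      = b * Real.exp (K * τ) - b := by field_simp; ring
    linarith

/-- A linear Volterra equation with delay `h` and integrable forcing has a continuous solution on
`[0, T]` with zero past. -/
theorem exists_delay_volterra {E : Type*} [NormedAddCommGroup E] [NormedSpace ℝ E]
    [CompleteSpace E] {A B : ℝ → E →L[ℝ] E} {f : ℝ → E} {T h : ℝ} (hT : 0 ≤ T) (hh : 0 ≤ h)
    (hA : ContinuousOn A (Icc 0 T)) (hB : ContinuousOn B (Icc 0 T))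
    (hf : IntervalIntegrable f volume 0 T) :
    ∃ u : ℝ → E, Continuous u ∧ (∀ s ≤ 0, u s = 0) ∧
      ∀ τ ∈ Icc 0 T, u τ = ∫ s in (0 : ℝ)..τ, (A s (u s) + B s (u (s - h)) + f s) := by
  have huI : uIcc 0 T = Icc 0 T := uIcc_of_le hT
  obtain ⟨K₁, hK₁⟩ := isCompact_Icc.exists_bound_of_continuousOn hA
  obtain ⟨K₂, hK₂⟩ := isCompact_Icc.exists_bound_of_continuousOn hB
  obtain ⟨K, hK1, hKA, hKB⟩ : ∃ K : ℝ, 1 ≤ K ∧ (∀ s ∈ Icc 0 T, ‖A s‖ ≤ K) ∧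
      ∀ s ∈ Icc 0 T, ‖B s‖ ≤ K :=
    ⟨max 1 (max K₁ K₂), le_max_left _ _,
      fun s hs => (hK₁ s hs).trans ((le_max_left _ _).trans (le_max_right _ _)),
      fun s hs => (hK₂ s hs).trans ((le_max_right _ _).trans (le_max_right _ _))⟩
  -- The weight `exp (-l τ)` makes the integral operator a contraction on the whole interval.
  set l : ℝ := 4 * K with hl
  have hl0 : 0 < l := by linarith
  -- `IccExtend` continues `d` by `d 0` to negative times; the fixed point has `d 0 = 0`, so for it
  -- this is the required zero past.
  set D : C(Icc 0 T, E) → ℝ → E := fun d => IccExtend hT d with hD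
  have hDc : ∀ d, Continuous (D d) := fun d => d.continuous.Icc_extend'
  set I : C(Icc 0 T, E) → ℝ → E := fun d s =>
    A s (Real.exp (l * s) • D d s) + B s (Real.exp (l * (s - h)) • D d (s - h)) + f s with hI
  have hIi : ∀ d, IntervalIntegrable (I d) volume 0 T := by
    intro d
    have hc1 : Continuous fun s => Real.exp (l * s) • D d s := by
      have := hDc d; fun_prop
    have hc2 : Continuous fun s => Real.exp (l * (s - h)) • D d (s - h) := by
      have := hDc d; fun_prop
    refine IntervalIntegrable.add (ContinuousOn.intervalIntegrable ?_) hf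
    rw [huI]
    exact (hA.clm_apply hc1.continuousOn).add (hB.clm_apply hc2.continuousOn)
  have hIt : ∀ d, ∀ τ ∈ Icc 0 T, IntervalIntegrable (I d) volume 0 τ := fun d τ hτ =>
    (hIi d).mono_set (by rw [uIcc_of_le hτ.1, huI]; exact Icc_subset_Icc_right hτ.2)
  have hprim : ∀ d, ContinuousOn (fun τ => Real.exp (-(l * τ)) • ∫ s in (0 : ℝ)..τ, I d s)
      (Icc 0 T) := by
    intro d
    have := intervalIntegral.continuousOn_primitive_interval' (hIi d) left_mem_uIcc
    rw [huI] at this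
    exact ContinuousOn.smul (by fun_prop) this
  set Q : C(Icc 0 T, E) → C(Icc 0 T, E) := fun d =>
    ⟨fun τ => Real.exp (-(l * τ)) • ∫ s in (0 : ℝ)..τ, I d s,
      continuousOn_iff_continuous_domRestrict.1 (hprim d)⟩ with hQ
  have hctr : ContractingWith (1 / 2) Q := by
    refine ⟨by rw [div_lt_one] <;> norm_num, LipschitzWith.of_dist_le_mul fun d e => ?_⟩
    rw [ContinuousMap.dist_le (by positivity)]
    intro τ
    have hτ := τ.2
    have hpt : ∀ s ∈ Icc 0 T, ‖I d s - I e s‖ ≤ (2 * K * dist d e) * Real.exp (l * s) := by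
      intro s hs
      have hde : ∀ r, ‖D d r - D e r‖ ≤ dist d e := fun r => by
        rw [← dist_eq_norm]; exact ContinuousMap.dist_apply_le_dist _
      have e1 : I d s - I e s = A s (Real.exp (l * s) • (D d s - D e s)) +
          B s (Real.exp (l * (s - h)) • (D d (s - h) - D e (s - h))) := by
        simp only [hI, smul_sub, map_sub]; abel
      have h1 : ‖A s (Real.exp (l * s) • (D d s - D e s))‖ ≤ K * (Real.exp (l * s) * dist d e) := by
        refine (A s).le_of_opNorm_le_of_le (hKA s hs) ?_
        rw [norm_smul, Real.norm_of_nonneg (Real.exp_pos _).le]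
        exact mul_le_mul_of_nonneg_left (hde s) (Real.exp_pos _).le
      have h2 : ‖B s (Real.exp (l * (s - h)) • (D d (s - h) - D e (s - h)))‖ ≤
          K * (Real.exp (l * s) * dist d e) := by
        refine (B s).le_of_opNorm_le_of_le (hKB s hs) ?_
        rw [norm_smul, Real.norm_of_nonneg (Real.exp_pos _).le]
        refine mul_le_mul (Real.exp_le_exp.2 ?_) (hde _) (norm_nonneg _) (Real.exp_pos _).le
        exact mul_le_mul_of_nonneg_left (by linarith) hl0.le
      rw [e1]
      refine (norm_add_le _ _).trans ((add_le_add h1 h2).trans (le_of_eq (by ring)))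
    have e2 : dist (Q d τ) (Q e τ) =
        Real.exp (-(l * τ)) * ‖∫ s in (0 : ℝ)..τ, (I d s - I e s)‖ := by
      rw [dist_eq_norm, intervalIntegral.integral_sub (hIt d τ hτ) (hIt e τ hτ)]
      change ‖Real.exp (-(l * τ)) • (∫ s in (0 : ℝ)..τ, I d s) -
        Real.exp (-(l * τ)) • (∫ s in (0 : ℝ)..τ, I e s)‖ = _
      rw [← smul_sub, norm_smul, Real.norm_of_nonneg (Real.exp_pos _).le]
    have h3 : ‖∫ s in (0 : ℝ)..τ, (I d s - I e s)‖ ≤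
        ∫ s in (0 : ℝ)..τ, (2 * K * dist d e) * Real.exp (l * s) := by
      refine intervalIntegral.norm_integral_le_of_norm_le hτ.1 ?_ ?_
      · filter_upwards with s hs using hpt s ⟨hs.1.le, hs.2.trans hτ.2⟩
      · exact Continuous.intervalIntegrable (by fun_prop) _ _
    have h4 : ∫ s in (0 : ℝ)..τ, (2 * K * dist d e) * Real.exp (l * s) =
        (2 * K * dist d e) * ((Real.exp (l * τ) - 1) / l) := by
      rw [intervalIntegral.integral_const_mul,
        intervalIntegral.integral_comp_mul_left (fun s => Real.exp s) hl0.ne', integral_exp]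
      simp [div_eq_inv_mul]
    rw [e2]
    have h5 : Real.exp (-(l * τ)) * Real.exp (l * τ) = 1 := by rw [← Real.exp_add]; simp
    calc Real.exp (-(l * τ)) * ‖∫ s in (0 : ℝ)..τ, (I d s - I e s)‖
        ≤ Real.exp (-(l * τ)) * ((2 * K * dist d e) * ((Real.exp (l * τ) - 1) / l)) :=
          mul_le_mul_of_nonneg_left (h3.trans_eq h4) (Real.exp_pos _).le
      _ = 1 / 2 * dist d e * (Real.exp (-(l * τ)) * Real.exp (l * τ) - Real.exp (-(l * τ))) := by
          rw [hl]; field_simp; ring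
      _ ≤ 1 / 2 * dist d e * 1 := by
          refine mul_le_mul_of_nonneg_left ?_ (by positivity)
          rw [h5]; linarith [Real.exp_pos (-(l * τ))]
      _ = _ := by simp
  set d := hctr.fixedPoint Q with hd
  have hfix : Q d = d := hctr.fixedPoint_isFixedPt
  have hd0 : ∀ s ≤ 0, D d s = 0 := by
    intro s hs
    simp only [hD, IccExtend_of_le_left hT d hs]
    rw [← hfix]
    change Real.exp (-(l * 0)) • (∫ s in (0 : ℝ)..0, I d s) = 0
    simp
  refine ⟨fun s => Real.exp (l * s) • D d s, ?_, fun s hs => by simp [hd0 s hs], fun τ hτ => ?_⟩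
  · have := hDc d; fun_prop
  · have e1 : D d τ = Real.exp (-(l * τ)) • ∫ s in (0 : ℝ)..τ, I d s := by
      simp only [hD, IccExtend_of_mem hT d hτ]
      conv_lhs => rw [← hfix]
      rfl
    change Real.exp (l * τ) • D d τ = _
    rw [e1, smul_smul, ← Real.exp_add]
    simp [hI]

theorem IntervalIntegrable.mulVec {m n : ℕ} {M : ℝ → Matrix (Fin m) (Fin n) ℝ}
    {y : ℝ → Fin n → ℝ} {a b : ℝ} (hM : ContinuousOn M (uIcc a b))
    (hy : IntervalIntegrable y volume a b) :
    IntervalIntegrable (fun s => M s *ᵥ y s) volume a b := by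
  rw [intervalIntegrable_iff] at hy ⊢
  rw [IntegrableOn, integrable_pi_iff] at hy ⊢
  intro i
  change Integrable (fun s => ∑ j, M s i j * y s j) _
  refine integrable_finsetSum _ fun j _ => ?_
  have h1 : IntervalIntegrable (fun s => y s j) volume a b := intervalIntegrable_iff.2 (hy j)
  have h2 : ContinuousOn (fun s => M s i j) (uIcc a b) :=
    (continuous_id.matrix_elem i j).comp_continuousOn hM
  exact intervalIntegrable_iff.1 (h1.continuousOn_mul h2)

/-! ### Existence of solutions, linearity and nonnegative majorants -/

theorem intervalIntegrable_ite_le {E : Type*} [NormedAddCommGroup E] {f g : ℝ → E} {a b : ℝ}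
    (c : ℝ) (hf : IntervalIntegrable f volume a b) (hg : IntervalIntegrable g volume a b) :
    IntervalIntegrable (fun s => if s ≤ c then f s else g s) volume a b := by
  rw [intervalIntegrable_iff] at hf hg ⊢
  exact Integrable.piecewise (s := Iic c) measurableSet_Iic hf.integrableOn hg.integrableOn

theorem MeasureTheory.LocallyIntegrableOn.intervalIntegrable_Ici {E : Type*}
    [NormedAddCommGroup E] {w : ℝ → E} (hw : LocallyIntegrableOn w (Ici 0)) {a b : ℝ}
    (ha : 0 ≤ a) (hb : 0 ≤ b) : IntervalIntegrable w volume a b := by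
  rw [intervalIntegrable_iff]
  refine (hw.integrableOn_compact_subset (t := uIcc a b) ?_ isCompact_uIcc).mono_set
    uIoc_subset_uIcc
  intro s hs
  exact (le_min ha hb).trans hs.1

theorem MeasureTheory.LocallyIntegrableOn.abs_pi {m : ℕ} {w : ℝ → Fin m → ℝ} {s : Set ℝ}
    (hw : LocallyIntegrableOn w s) : LocallyIntegrableOn |w| s := by
  intro r hr
  obtain ⟨u, hu, h⟩ := hw r hr
  refine ⟨u, hu, ?_⟩
  rw [IntegrableOn, integrable_pi_iff] at h ⊢
  exact fun i => (h i).abs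

theorem IsImpulseSequence.monotone {t : ℕ → ℝ} (ht : IsImpulseSequence t) : Monotone t :=
  monotone_nat_of_le_succ fun k => (ht.lt_succ k).le

theorem IsImpulseSequence.nonneg {t : ℕ → ℝ} (ht : IsImpulseSequence t) (k : ℕ) : 0 ≤ t k :=
  ht.zero ▸ ht.monotone (Nat.zero_le k)

theorem continuous_toContinuousLinearMap {m n : ℕ} :
    Continuous fun M : Matrix (Fin m) (Fin n) ℝ => LinearMap.toContinuousLinearMap
      (Matrix.toLin' M) :=
  LinearMap.continuous_of_finiteDimensional
    ((LinearMap.toContinuousLinearMap.toLinearMap.comp (Matrix.toLin').toLinearMap :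
      Matrix (Fin m) (Fin n) ℝ →ₗ[ℝ] ((Fin n → ℝ) →L[ℝ] (Fin m → ℝ))))

theorem exists_norm_mulVec_le {m n : ℕ} {M : ℝ → Matrix (Fin m) (Fin n) ℝ} {a b : ℝ}
    (hM : ContinuousOn M (Icc a b)) :
    ∃ K, 0 ≤ K ∧ ∀ τ ∈ Icc a b, ∀ v, ‖M τ *ᵥ v‖ ≤ K * ‖v‖ := by
  obtain ⟨K, hK⟩ := isCompact_Icc.exists_bound_of_continuousOn
    (continuous_toContinuousLinearMap.comp_continuousOn hM)
  refine ⟨max K 0, le_max_right _ _, fun τ hτ v => ?_⟩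
  exact (LinearMap.toContinuousLinearMap (Matrix.toLin' (M τ))).le_of_opNorm_le
    ((hK τ hτ).trans (le_max_left _ _)) v

namespace ImpulsiveDelaySystem

variable {n pc pd qc qd : ℕ} (S : ImpulsiveDelaySystem n pc pd qc qd)

/-- A given past `y` and a post-jump value `v` extend to a solution of the flow equation on the
next dwell interval. -/
theorem exists_flow_extension {hc tk T : ℝ} (hhc : 0 ≤ hc) (hT : 0 ≤ T) {wc : ℝ → Fin pc → ℝ}
    (hw : IntervalIntegrable wc volume tk (tk + T)) {y : ℝ → Fin n → ℝ}
    (hy : ∀ a b, IntervalIntegrable y volume a b) (v : Fin n → ℝ) :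
    ∃ y' : ℝ → Fin n → ℝ, (∀ a b, IntervalIntegrable y' volume a b) ∧ (∀ s ≤ tk, y' s = y s) ∧
      IntervalIntegrable (S.flowField hc tk wc y') volume 0 T ∧
      ∀ τ ∈ Ioc 0 T, y' (tk + τ) = v + ∫ s in (0 : ℝ)..τ, S.flowField hc tk wc y' s := by
  have huI : uIcc 0 T = Icc 0 T := uIcc_of_le hT
  have hsub : uIcc 0 T ⊆ Ici 0 := huI ▸ Icc_subset_Ici_self
  -- With `past` equal to `v` at positive times, the unknown `u` is the deviation of the solution from
  -- `v`; it vanishes at timer value `0`, so its extension by zero is continuous.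
  set past : ℝ → Fin n → ℝ := fun r => if r ≤ 0 then y (tk + r) else v with hpast
  have hpi : IntervalIntegrable (fun s => past (s - hc)) volume 0 T := by
    have h1 : IntervalIntegrable past volume (0 - hc) (T - hc) := by
      refine intervalIntegrable_ite_le 0 ?_ intervalIntegrable_const
      simpa using (hy (tk + (0 - hc)) (tk + (T - hc))).comp_add_left tk
    simpa using h1.comp_sub_right hc
  have hwi : IntervalIntegrable (fun s => wc (tk + s)) volume 0 T := by
    simpa using hw.comp_add_left tk
  set f : ℝ → Fin n → ℝ := fun s =>
    S.A s *ᵥ v + S.Gc s *ᵥ past (s - hc) + S.Ec s *ᵥ wc (tk + s) with hf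
  have hfi : IntervalIntegrable f volume 0 T :=
    (((intervalIntegrable_const (c := v)).mulVec (S.continuousOn_A.mono hsub)).add
      (hpi.mulVec (S.continuousOn_Gc.mono hsub))).add (hwi.mulVec (S.continuousOn_Ec.mono hsub))
  obtain ⟨u, huc, hu0, hu⟩ := exists_delay_volterra hT hhc
    (continuous_toContinuousLinearMap.comp_continuousOn (S.continuousOn_A.mono (huI ▸ hsub)))
    (continuous_toContinuousLinearMap.comp_continuousOn (S.continuousOn_Gc.mono (huI ▸ hsub))) hfi
  simp only [Function.comp_apply, LinearMap.coe_toContinuousLinearMap', Matrix.toLin'_apply] at hu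
  set y' : ℝ → Fin n → ℝ := fun s => if s ≤ tk then y s else v + u (s - tk) with hy'
  have hflow : ∀ s ∈ Ioc 0 T, S.flowField hc tk wc y' s =
      S.A s *ᵥ u s + S.Gc s *ᵥ u (s - hc) + f s := by
    intro s hs
    have e1 : y' (tk + s) = v + u s := by
      have : ¬ s ≤ 0 := not_le.2 hs.1
      simp [hy', this]
    have e2 : y' (tk + s - hc) = past (s - hc) + u (s - hc) := by
      simp only [hy', hpast]
      by_cases h : s - hc ≤ 0
      · rw [if_pos (by linarith), if_pos h, hu0 _ h, add_zero]; congr 1; ring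
      · rw [if_neg (by linarith), if_neg h]; congr 2; ring
    simp only [flowField, e1, e2, hf, Matrix.mulVec_add]
    abel
  have hui : IntervalIntegrable (fun s => S.A s *ᵥ u s + S.Gc s *ᵥ u (s - hc) + f s)
      volume 0 T :=
    ((huc.intervalIntegrable 0 T).mulVec (S.continuousOn_A.mono hsub) |>.add
      (((huc.comp (continuous_id.sub continuous_const)).intervalIntegrable 0 T).mulVec
        (S.continuousOn_Gc.mono hsub))).add hfi
  refine ⟨y', fun a b => ?_, fun s hs => if_pos hs, ?_, fun τ hτ => ?_⟩
  · refine intervalIntegrable_ite_le tk (hy a b) (Continuous.intervalIntegrable ?_ a b)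
    fun_prop
  · refine hui.congr ?_
    rw [uIoc_of_le hT]
    intro s hs
    exact (hflow s hs).symm
  · have e1 : y' (tk + τ) = v + u τ := by
      have : ¬ τ ≤ 0 := not_le.2 hτ.1
      simp [hy', this]
    rw [e1, hu τ ⟨hτ.1.le, hτ.2⟩]
    congr 1
    exact intervalIntegral.integral_congr_Ioo_of_le hτ.1.le fun s hs =>
      (hflow s ⟨hs.1, hs.2.le.trans hτ.2⟩).symm

/-- The jump depends on the state only up to the impulse time. -/
theorem postJump_congr {hd : ℕ} {t : ℕ → ℝ} (ht : IsImpulseSequence t) (ψ : Fin hd → Fin n → ℝ)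
    (wd : ℕ → Fin pd → ℝ) {x y : ℝ → Fin n → ℝ} {k : ℕ} (h : ∀ s ≤ t k, x s = y s) :
    S.postJump hd t ψ wd x k = S.postJump hd t ψ wd y k := by
  simp only [postJump, delayedSample]
  rw [h 0 (ht.nonneg k), h (t k) le_rfl, h (t (k - hd)) (ht.monotone (Nat.sub_le k hd))]

/-- Solutions exist for all delays, impulse times, initial data and locally integrable inputs: they
are extended one dwell interval at a time, and the extensions are glued together. -/
theorem exists_isSolution {hc : ℝ} (hhc : 0 ≤ hc) (hd : ℕ) {t : ℕ → ℝ}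
    (ht : IsImpulseSequence t) (φ : C(Icc (-hc) (0 : ℝ), Fin n → ℝ)) (ψ : Fin hd → Fin n → ℝ)
    {wc : ℝ → Fin pc → ℝ} (hw : LocallyIntegrableOn wc (Ici 0)) (wd : ℕ → Fin pd → ℝ) :
    ∃ x, S.IsSolution hc hd t φ ψ wc wd x := by
  let Y := {y : ℝ → Fin n → ℝ // ∀ a b, IntervalIntegrable y volume a b}
  have hstep : ∀ (k : ℕ) (y : Y), ∃ y' : Y, (∀ s ≤ t k, y'.1 s = y.1 s) ∧
      IntervalIntegrable (S.flowField hc (t k) wc y'.1) volume 0 (t (k + 1) - t k) ∧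
      ∀ τ ∈ Ioc 0 (t (k + 1) - t k), y'.1 (t k + τ) = S.postJump hd t ψ wd y.1 k +
        ∫ s in (0 : ℝ)..τ, S.flowField hc (t k) wc y'.1 s := by
    intro k y
    have hk := (ht.lt_succ k).le
    obtain ⟨y', h1, h2, h3, h4⟩ := S.exists_flow_extension hhc (sub_nonneg.2 hk)
      (hw.intervalIntegrable_Ici (ht.nonneg k) (by linarith [ht.nonneg k])) y.2
      (S.postJump hd t ψ wd y.1 k)
    exact ⟨⟨y', h1⟩, h2, h3, h4⟩
  choose step hst1 hst2 hst3 using hstep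
  have hc0 : -hc ≤ 0 := by linarith
  let y0 : Y := ⟨IccExtend hc0 φ, fun a b =>
    (φ.continuous.Icc_extend').intervalIntegrable a b⟩
  let y : ℕ → Y := fun k => Nat.rec y0 step k
  have hagree : ∀ k m, k ≤ m → ∀ s ≤ t k, (y m).1 s = (y k).1 s := by
    intro k m hkm
    induction m, hkm using Nat.le_induction with
    | base => exact fun _ _ => rfl
    | succ m hkm ih =>
      intro s hs
      exact (hst1 m (y m) s (hs.trans (ht.monotone hkm))).trans (ih s hs)
  have hN : ∀ s : ℝ, ∃ k, s ≤ t k := fun s => (ht.tendsto.eventually_ge_atTop s).exists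
  choose N hN using hN
  let x : ℝ → Fin n → ℝ := fun s => (y (N s)).1 s
  have hx : ∀ k, ∀ s ≤ t k, x s = (y k).1 s := by
    intro k s hs
    rcases le_total k (N s) with h | h
    · exact hagree _ _ h s hs
    · exact (hagree _ _ h s (hN s)).symm
  have hfl : ∀ k, EqOn (S.flowField hc (t k) wc (y (k + 1)).1) (S.flowField hc (t k) wc x)
      (Ioc 0 (t (k + 1) - t k)) := by
    intro k s hs
    simp only [flowField]
    rw [hx (k + 1) (t k + s) (by linarith [hs.2]), hx (k + 1) (t k + s - hc) (by linarith [hs.2])]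
  refine ⟨x, ⟨fun s => ?_, fun k => ?_, fun k τ hτ => ?_⟩⟩
  · rw [hx 0 s (by rw [ht.zero]; exact s.2.2)]
    exact IccExtend_val hc0 φ s
  · refine (hst2 k (y k)).congr ?_
    rw [uIoc_of_le (sub_nonneg.2 (ht.lt_succ k).le)]
    exact hfl k
  · rw [hx (k + 1) _ (by linarith [hτ.2]), S.postJump_congr ht ψ wd (hx k)]
    refine (hst3 k (y k) τ hτ).trans ?_
    congr 1
    exact intervalIntegral.integral_congr_Ioo_of_le hτ.1.le fun s hs =>
      hfl k ⟨hs.1, hs.2.le.trans hτ.2⟩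

section Linearity

variable {hc : ℝ} {hd : ℕ} {t : ℕ → ℝ} {φ φ' : C(Icc (-hc) (0 : ℝ), Fin n → ℝ)}
  {ψ ψ' : Fin hd → Fin n → ℝ} {wc wc' : ℝ → Fin pc → ℝ} {wd wd' : ℕ → Fin pd → ℝ}
  {x x' : ℝ → Fin n → ℝ}

theorem flowField_add (hc tk : ℝ) (wc wc' : ℝ → Fin pc → ℝ) (x x' : ℝ → Fin n → ℝ) :
    S.flowField hc tk (wc + wc') (x + x') =
      S.flowField hc tk wc x + S.flowField hc tk wc' x' := by
  funext s
  simp only [flowField, Pi.add_apply, Matrix.mulVec_add]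
  abel

theorem flowField_neg (hc tk : ℝ) (wc : ℝ → Fin pc → ℝ) (x : ℝ → Fin n → ℝ) :
    S.flowField hc tk (-wc) (-x) = -S.flowField hc tk wc x := by
  funext s
  simp only [flowField, Pi.neg_apply, Matrix.mulVec_neg]
  abel

theorem delayedSample_add (hd : ℕ) (t : ℕ → ℝ) (ψ ψ' : Fin hd → Fin n → ℝ)
    (x x' : ℝ → Fin n → ℝ) (k : ℕ) :
    delayedSample hd t (ψ + ψ') (x + x') k =
      delayedSample hd t ψ x k + delayedSample hd t ψ' x' k := by
  simp only [delayedSample]; split_ifs <;> rfl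

theorem delayedSample_neg (hd : ℕ) (t : ℕ → ℝ) (ψ : Fin hd → Fin n → ℝ)
    (x : ℝ → Fin n → ℝ) (k : ℕ) :
    delayedSample hd t (-ψ) (-x) k = -delayedSample hd t ψ x k := by
  simp only [delayedSample]; split_ifs <;> rfl

variable {S}

theorem IsSolution.add (hx : S.IsSolution hc hd t φ ψ wc wd x)
    (hx' : S.IsSolution hc hd t φ' ψ' wc' wd' x') :
    S.IsSolution hc hd t (φ + φ') (ψ + ψ') (wc + wc') (wd + wd') (x + x') := by
  refine ⟨fun s => ?_, fun k => ?_, fun k τ hτ => ?_⟩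
  · simp [hx.history, hx'.history]
  · rw [flowField_add]; exact (hx.integrable k).add (hx'.integrable k)
  · have hsub : uIcc 0 τ ⊆ uIcc 0 (t (k + 1) - t k) := by
      rw [uIcc_of_le hτ.1.le, uIcc_of_le (hτ.1.le.trans hτ.2)]; exact Icc_subset_Icc_right hτ.2
    have e : S.postJump hd t (ψ + ψ') (wd + wd') (x + x') k =
        S.postJump hd t ψ wd x k + S.postJump hd t ψ' wd' x' k := by
      simp only [postJump]
      split_ifs
      · rfl
      · rw [delayedSample_add]; simp only [Pi.add_apply, Matrix.mulVec_add]; abel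
    rw [flowField_add, e]
    have := intervalIntegral.integral_add ((hx.integrable k).mono_set hsub)
      ((hx'.integrable k).mono_set hsub)
    simp only [Pi.add_apply]
    rw [this, hx.flow k τ hτ, hx'.flow k τ hτ]
    abel

theorem IsSolution.neg (hx : S.IsSolution hc hd t φ ψ wc wd x) :
    S.IsSolution hc hd t (-φ) (-ψ) (-wc) (-wd) (-x) := by
  refine ⟨fun s => ?_, fun k => ?_, fun k τ hτ => ?_⟩
  · simp [hx.history]
  · rw [flowField_neg]; exact (hx.integrable k).neg
  · have e : S.postJump hd t (-ψ) (-wd) (-x) k = -S.postJump hd t ψ wd x k := by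
      simp only [postJump]
      split_ifs
      · rfl
      · rw [delayedSample_neg]; simp only [Pi.neg_apply, Matrix.mulVec_neg]; abel
    rw [flowField_neg, e]
    simp only [Pi.neg_apply]
    rw [intervalIntegral.integral_neg, hx.flow k τ hτ]
    abel

theorem zc_add (s : ℝ) : S.zc hc (wc + wc') (x + x') s = S.zc hc wc x s + S.zc hc wc' x' s := by
  simp only [zc, Pi.add_apply, Matrix.mulVec_add]
  abel

theorem zc_neg (s : ℝ) : S.zc hc (-wc) (-x) s = -S.zc hc wc x s := by
  simp only [zc, Pi.neg_apply, Matrix.mulVec_neg]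
  abel

theorem zd_add (k : ℕ) : S.zd hd t (ψ + ψ') (wd + wd') (x + x') k =
    S.zd hd t ψ wd x k + S.zd hd t ψ' wd' x' k := by
  simp only [zd, delayedSample_add, Pi.add_apply, Matrix.mulVec_add]
  abel

theorem zd_neg (k : ℕ) : S.zd hd t (-ψ) (-wd) (-x) k = -S.zd hd t ψ wd x k := by
  simp only [zd, delayedSample_neg, Pi.neg_apply, Matrix.mulVec_neg]
  abel

/-- The componentwise absolute value of a vector-valued initial function. -/
def absHistory (φ : C(Icc (-hc) (0 : ℝ), Fin n → ℝ)) : C(Icc (-hc) (0 : ℝ), Fin n → ℝ) :=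
  ⟨fun s => |φ s|, continuous_pi fun i => ((continuous_apply i).comp φ.continuous).abs⟩

theorem norm_absHistory_le (φ : C(Icc (-hc) (0 : ℝ), Fin n → ℝ)) (ψ : Fin hd → Fin n → ℝ) :
    ‖(absHistory φ, |ψ|)‖ ≤ ‖(φ, ψ)‖ := by
  refine max_le_max ?_ ?_
  · refine (ContinuousMap.norm_le _ (norm_nonneg _)).2 fun s => ?_
    refine le_trans ?_ (φ.norm_coe_le_norm s)
    refine (pi_norm_le_iff_of_nonneg (norm_nonneg _)).2 fun i => ?_
    exact (norm_norm (φ s i)).trans_le (norm_le_pi_norm (φ s) i)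
  · refine (pi_norm_le_iff_of_nonneg (norm_nonneg _)).2 fun j => ?_
    refine le_trans ?_ (norm_le_pi_norm ψ j)
    refine (pi_norm_le_iff_of_nonneg (norm_nonneg _)).2 fun i => ?_
    exact (norm_norm (ψ j i)).trans_le (norm_le_pi_norm (ψ j) i)

/-- A solution of an internally positive system is dominated, together with its outputs, by a
nonnegative solution whose data are the absolute values of the given data. -/
theorem InternallyPositive.exists_majorant (hpos : S.InternallyPositive) (hhc : 0 < hc)
    (ht : IsImpulseSequence t) (hw : LocallyIntegrableOn wc (Ici 0))
    (hx : S.IsSolution hc hd t φ ψ wc wd x) :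
    ∃ X, S.IsSolution hc hd t (absHistory φ) |ψ| |wc| |wd| X ∧
      (∀ s, -hc ≤ s → |x s| ≤ X s) ∧ (∀ s, 0 < s → |S.zc hc wc x s| ≤ S.zc hc |wc| X s) ∧
      ∀ k, 1 ≤ k → |S.zd hd t ψ wd x k| ≤ S.zd hd t |ψ| |wd| X k := by
  have hw' : LocallyIntegrableOn |wc| (Ici 0) := hw.abs_pi
  obtain ⟨X, hX⟩ := S.exists_isSolution hhc.le hd ht (absHistory φ) |ψ| hw' |wd|
  have hp := hpos hc hd t hhc ht _ _ _ _ _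
    (fun s i => by
      have := neg_abs_le (φ s i); change (0 : ℝ) ≤ |φ s i| + φ s i; linarith)
    (fun j i => by have := neg_abs_le (ψ j i); change (0 : ℝ) ≤ |ψ j i| + ψ j i; linarith)
    (hw'.add hw)
    (fun s _ i => by have := neg_abs_le (wc s i); change (0 : ℝ) ≤ |wc s i| + wc s i; linarith)
    (fun k _ i => by have := neg_abs_le (wd k i); change (0 : ℝ) ≤ |wd k i| + wd k i; linarith)
    (hX.add hx)
  have hm := hpos hc hd t hhc ht _ _ _ _ _
    (fun s i => by
      have := le_abs_self (φ s i); change (0 : ℝ) ≤ |φ s i| + -φ s i; linarith)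
    (fun j i => by have := le_abs_self (ψ j i); change (0 : ℝ) ≤ |ψ j i| + -ψ j i; linarith)
    (hw'.add hw.neg)
    (fun s _ i => by have := le_abs_self (wc s i); change (0 : ℝ) ≤ |wc s i| + -wc s i; linarith)
    (fun k _ i => by have := le_abs_self (wd k i); change (0 : ℝ) ≤ |wd k i| + -wd k i; linarith)
    (hX.add hx.neg)
  refine ⟨X, hX, fun s hs => ?_, fun s hs => ?_, fun k hk => ?_⟩
  · rcases le_total s 0 with h0 | h0
    · have e1 := hX.history ⟨s, hs, h0⟩
      have e2 := hx.history ⟨s, hs, h0⟩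
      simp only at e1 e2
      rw [e1, e2]
      exact le_rfl
    · refine abs_le'.2 ⟨?_, ?_⟩
      · have := hm.1 s h0; rw [Pi.add_apply, Pi.neg_apply] at this
        exact sub_nonneg.1 (by rwa [sub_eq_add_neg])
      · have := hp.1 s h0; rw [Pi.add_apply] at this
        exact sub_nonneg.1 (by rwa [sub_neg_eq_add])
  · refine abs_le'.2 ⟨?_, ?_⟩
    · have := hm.2.1 s hs; rw [zc_add, zc_neg] at this
      exact sub_nonneg.1 (by rwa [sub_eq_add_neg])
    · have := hp.2.1 s hs; rw [zc_add] at this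
      exact sub_nonneg.1 (by rwa [sub_neg_eq_add])
  · refine abs_le'.2 ⟨?_, ?_⟩
    · have := hm.2.2 k hk; rw [zd_add, zd_neg] at this
      exact sub_nonneg.1 (by rwa [sub_eq_add_neg])
    · have := hp.2.2 k hk; rw [zd_add] at this
      exact sub_nonneg.1 (by rwa [sub_neg_eq_add])

end Linearity

end ImpulsiveDelaySystem

/-! ### Sign conditions forced by internal positivity -/

namespace ImpulsiveDelaySystem

variable {n pc pd qc qd : ℕ} (S : ImpulsiveDelaySystem n pc pd qc qd)

/-- The continuous representative of the state on the closed interval of timer values following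
the `k`-th impulse: it agrees with `x (t k + τ)` for `τ > 0` and takes the post-jump value at
`τ = 0`. -/
noncomputable def flowCurve (hc : ℝ) (hd : ℕ) (t : ℕ → ℝ) (ψ : Fin hd → Fin n → ℝ) (wc : ℝ → Fin pc → ℝ)
    (wd : ℕ → Fin pd → ℝ) (x : ℝ → Fin n → ℝ) (k : ℕ) (τ : ℝ) : Fin n → ℝ :=
  S.postJump hd t ψ wd x k + ∫ s in (0 : ℝ)..τ, S.flowField hc (t k) wc x s

variable {S} {hc : ℝ} {hd : ℕ} {t : ℕ → ℝ} {φ : C(Icc (-hc) (0 : ℝ), Fin n → ℝ)}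
  {ψ : Fin hd → Fin n → ℝ} {wc : ℝ → Fin pc → ℝ} {wd : ℕ → Fin pd → ℝ} {x : ℝ → Fin n → ℝ}

theorem flowCurve_zero (k : ℕ) :
    S.flowCurve hc hd t ψ wc wd x k 0 = S.postJump hd t ψ wd x k := by
  simp [flowCurve]

namespace IsSolution

theorem continuousOn_flowCurve (hx : S.IsSolution hc hd t φ ψ wc wd x)
    (ht : IsImpulseSequence t) (k : ℕ) :
    ContinuousOn (S.flowCurve hc hd t ψ wc wd x k) (Icc 0 (t (k + 1) - t k)) := by
  have h := intervalIntegral.continuousOn_primitive_interval' (hx.integrable k) left_mem_uIcc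
  rw [uIcc_of_le (sub_nonneg.2 (ht.lt_succ k).le)] at h
  exact continuousOn_const.add h

theorem eq_flowCurve (hx : S.IsSolution hc hd t φ ψ wc wd x) {k : ℕ} {s : ℝ}
    (hs : s ∈ Ioc (t k) (t (k + 1))) : x s = S.flowCurve hc hd t ψ wc wd x k (s - t k) := by
  have h := hx.flow k (s - t k) ⟨sub_pos.2 hs.1, sub_le_sub_right hs.2 _⟩
  rwa [add_sub_cancel] at h

theorem intervalIntegrable_succ (hx : S.IsSolution hc hd t φ ψ wc wd x)
    (ht : IsImpulseSequence t) (k : ℕ) : IntervalIntegrable x volume (t k) (t (k + 1)) := by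
  have h1 : ContinuousOn (fun s => S.flowCurve hc hd t ψ wc wd x k (s - t k))
      (uIcc (t k) (t (k + 1))) := by
    rw [uIcc_of_le (ht.lt_succ k).le]
    refine (hx.continuousOn_flowCurve ht k).comp (by fun_prop) fun s hs => ?_
    exact ⟨sub_nonneg.2 hs.1, sub_le_sub_right hs.2 _⟩
  refine h1.intervalIntegrable.congr ?_
  rw [uIoc_of_le (ht.lt_succ k).le]
  exact fun s hs => (hx.eq_flowCurve hs).symm

theorem intervalIntegrable (hx : S.IsSolution hc hd t φ ψ wc wd x) (hhc : 0 ≤ hc)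
    (ht : IsImpulseSequence t) {a b : ℝ} (ha : -hc ≤ a) (hb : -hc ≤ b) :
    IntervalIntegrable x volume a b := by
  have hc0 : -hc ≤ 0 := by linarith
  have h0 : IntervalIntegrable x volume (-hc) 0 := by
    refine ((φ.continuous.Icc_extend' (h := hc0)).intervalIntegrable _ _).congr ?_
    rw [uIoc_of_le hc0]
    intro s hs
    rw [IccExtend_of_mem hc0 φ ⟨hs.1.le, hs.2⟩]
    exact (hx.history ⟨s, hs.1.le, hs.2⟩).symm
  have hk : ∀ k, IntervalIntegrable x volume (-hc) (t k) := by
    intro k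
    induction k with
    | zero => rwa [ht.zero]
    | succ k ih => exact ih.trans (hx.intervalIntegrable_succ ht k)
  have hb' : ∀ c, -hc ≤ c → IntervalIntegrable x volume (-hc) c := by
    intro c hc
    obtain ⟨k, hk'⟩ := (ht.tendsto.eventually_ge_atTop c).exists
    refine (hk k).mono_set ?_
    rw [uIcc_of_le hc, uIcc_of_le (hc.trans hk')]
    exact Icc_subset_Icc_right hk'
  exact (hb' a ha).symm.trans (hb' b hb)

/-- The post-jump value is the right limit of the state, hence nonnegative. -/
theorem postJump_nonneg (hx : S.IsSolution hc hd t φ ψ wc wd x) (ht : IsImpulseSequence t)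
    (hx0 : ∀ s, 0 ≤ s → 0 ≤ x s) (k : ℕ) : 0 ≤ S.postJump hd t ψ wd x k := by
  have hT : 0 < t (k + 1) - t k := sub_pos.2 (ht.lt_succ k)
  have hcw : Tendsto (S.flowCurve hc hd t ψ wc wd x k) (𝓝[Ioc 0 (t (k + 1) - t k)] 0)
      (𝓝 (S.flowCurve hc hd t ψ wc wd x k 0)) :=
    ((hx.continuousOn_flowCurve ht k) 0 ⟨le_rfl, hT.le⟩).mono Ioc_subset_Icc_self
  rw [nhdsWithin_Ioc_eq_nhdsGT hT, flowCurve_zero] at hcw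
  refine ge_of_tendsto hcw ?_
  filter_upwards [Ioc_mem_nhdsGT hT] with τ hτ
  have := hx0 _ (add_nonneg (ht.nonneg k) hτ.1.le)
  rwa [hx.flow k τ hτ] at this

theorem flowCurve_nonneg (hx : S.IsSolution hc hd t φ ψ wc wd x) (ht : IsImpulseSequence t)
    (hx0 : ∀ s, 0 ≤ s → 0 ≤ x s) (k : ℕ) {τ : ℝ} (hτ : τ ∈ Icc 0 (t (k + 1) - t k)) :
    0 ≤ S.flowCurve hc hd t ψ wc wd x k τ := by
  rcases hτ.1.eq_or_lt with rfl | h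
  · rw [flowCurve_zero]; exact hx.postJump_nonneg ht hx0 k
  · have := hx0 _ (add_nonneg (ht.nonneg k) h.le)
    rwa [hx.flow k τ ⟨h, hτ.2⟩] at this

theorem eq_integral_first (hx : S.IsSolution hc hd t φ ψ wc wd x) (ht : IsImpulseSequence t)
    (h0 : x 0 = 0) {τ : ℝ} (hτ : τ ∈ Icc 0 (t 1)) :
    x τ = ∫ s in (0 : ℝ)..τ, S.flowField hc 0 wc x s := by
  rcases hτ.1.eq_or_lt with rfl | h
  · simpa using h0
  · have := hx.flow 0 τ ⟨h, by simpa [ht.zero] using hτ.2⟩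
    simpa [ht.zero, postJump, h0] using this

/-- Before the first impulse, an unforced solution starting at zero is controlled by its delayed
values. -/
theorem norm_le_first (hx : S.IsSolution hc hd t φ ψ 0 wd x) (hhc : 0 ≤ hc)
    (ht : IsImpulseSequence t) (h0 : x 0 = 0) {R K : ℝ} (hR0 : 0 ≤ R) (hR : R ≤ t 1)
    (hK : 0 ≤ K) (hA : ∀ τ ∈ Icc 0 R, ∀ v, ‖S.A τ *ᵥ v‖ ≤ K * ‖v‖)
    (hG : ∀ τ ∈ Icc 0 R, ∀ v, ‖S.Gc τ *ᵥ v‖ ≤ K * ‖v‖) :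
    ∀ τ ∈ Icc 0 R, ‖x τ‖ ≤ (K * ∫ s in (0 : ℝ)..R, ‖x (s - hc)‖) * Real.exp (K * τ) := by
  have hxc : ContinuousOn x (Icc 0 R) := by
    have h1 := hx.continuousOn_flowCurve ht 0
    simp only [ht.zero, zero_add, sub_zero] at h1
    refine (h1.mono (Icc_subset_Icc_right hR)).congr fun τ hτ => ?_
    rw [hx.eq_integral_first ht h0 ⟨hτ.1, hτ.2.trans hR⟩]
    simp [flowCurve, ht.zero, postJump, h0]
  have hdel : ∀ τ, 0 ≤ τ → IntervalIntegrable (fun s => ‖x (s - hc)‖) volume 0 τ := by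
    intro τ hτ
    have := (hx.intervalIntegrable hhc ht (a := 0 - hc) (b := τ - hc)
      (by linarith) (by linarith)).comp_sub_right hc
    simpa using this.norm
  refine norm_le_mul_exp_of_norm_le_integral hK hxc fun τ hτ => ?_
  have hxi : IntervalIntegrable (fun s => ‖x s‖) volume 0 τ :=
    (hx.intervalIntegrable hhc ht (by linarith) (by linarith [hτ.1])).norm
  rw [hx.eq_integral_first ht h0 ⟨hτ.1, hτ.2.trans hR⟩]
  calc ‖∫ s in (0 : ℝ)..τ, S.flowField hc 0 0 x s‖
      ≤ ∫ s in (0 : ℝ)..τ, (K * ‖x s‖ + K * ‖x (s - hc)‖) := by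
        refine intervalIntegral.norm_integral_le_of_norm_le hτ.1 ?_
          ((hxi.const_mul K).add ((hdel τ hτ.1).const_mul K))
        filter_upwards with s hs
        have hs' : s ∈ Icc 0 R := ⟨hs.1.le, hs.2.trans hτ.2⟩
        simp only [flowField, zero_add, Pi.zero_apply, Matrix.mulVec_zero, add_zero]
        exact (norm_add_le _ _).trans (add_le_add (hA s hs' _) (hG s hs' _))
    _ = K * (∫ s in (0 : ℝ)..τ, ‖x s‖) + K * ∫ s in (0 : ℝ)..τ, ‖x (s - hc)‖ := by
        rw [intervalIntegral.integral_add (hxi.const_mul K) ((hdel τ hτ.1).const_mul K),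
          intervalIntegral.integral_const_mul, intervalIntegral.integral_const_mul]
    _ ≤ _ := by
        rw [add_comm]
        refine add_le_add_left (mul_le_mul_of_nonneg_left ?_ hK) _
        exact intervalIntegral.integral_mono_interval le_rfl hτ.1 hτ.2
          (Eventually.of_forall fun s => norm_nonneg _) (hdel R hR0)

end IsSolution

theorem isImpulseSequence_mul {c : ℝ} (hc : 0 < c) : IsImpulseSequence fun k : ℕ => k * c :=
  ⟨by simp, fun k => by push_cast; linarith,
    tendsto_natCast_atTop_atTop.atTop_mul_const hc⟩

namespace InternallyPositive

/-- A solution with zero initial function and no inputs vanishes up to the first impulse, where only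
the discrete history enters the jump and the discrete output. Positivity of both gives the signs. -/
theorem nonneg_Gd_Hd (hpos : S.InternallyPositive) :
    (∀ i j, 0 ≤ S.Gd i j) ∧ ∀ i j, 0 ≤ S.Hd i j := by
  suffices h : ∀ j, 0 ≤ S.Gd *ᵥ Pi.single j 1 ∧ 0 ≤ S.Hd *ᵥ Pi.single j 1 by
    refine ⟨fun i j => ?_, fun i j => ?_⟩
    · simpa using (h j).1 i
    · simpa using (h j).2 i
  intro j
  have ht := isImpulseSequence_mul (c := 1) one_pos
  -- For `hd = 2` the sample entering the jump at `k = 1` is the prescribed history value `ψ 1`.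
  obtain ⟨x, hx⟩ := S.exists_isSolution (hc := 1) zero_le_one 2 ht 0
    (fun _ => Pi.single j 1) (wc := 0) (locallyIntegrableOn_const 0) 0
  obtain ⟨hx0, -, hz⟩ := hpos 1 2 _ one_pos ht _ _ _ _ _ (fun _ => le_rfl)
    (fun _ => Pi.single_nonneg.2 zero_le_one)
    (locallyIntegrableOn_const 0) (fun _ _ => le_rfl) (fun _ _ => le_rfl) hx
  have hist : ∀ s ∈ Icc (-1 : ℝ) 0, x s = 0 := fun s hs => hx.history ⟨s, hs⟩
  obtain ⟨K₁, hK₁, hA⟩ := exists_norm_mulVec_le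
    (S.continuousOn_A.mono (Icc_subset_Ici_self : Icc 0 (1 : ℝ) ⊆ Ici 0))
  obtain ⟨K₂, hK₂, hG⟩ := exists_norm_mulVec_le
    (S.continuousOn_Gc.mono (Icc_subset_Ici_self : Icc 0 (1 : ℝ) ⊆ Ici 0))
  have hb := hx.norm_le_first zero_le_one ht (hist 0 ⟨by norm_num, le_rfl⟩) zero_le_one
    (by simp) (hK₁.trans (le_max_left K₁ K₂))
    (fun τ hτ v => (hA τ hτ v).trans (by gcongr; exact le_max_left _ _))
    (fun τ hτ v => (hG τ hτ v).trans (by gcongr; exact le_max_right _ _)) 1 ⟨zero_le_one, le_rfl⟩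
  have hI : ∫ s in (0 : ℝ)..1, ‖x (s - 1)‖ = 0 := by
    refine (intervalIntegral.integral_congr (g := fun _ => (0 : ℝ)) fun s hs => ?_).trans (by simp)
    rw [uIcc_of_le zero_le_one] at hs
    simp only
    rw [hist (s - 1) ⟨by linarith [hs.1], by linarith [hs.2]⟩, norm_zero]
  rw [hI, mul_zero, zero_mul] at hb
  have hx1 : x 1 = 0 := norm_le_zero_iff.1 hb
  have h1 := hx.postJump_nonneg ht hx0 1
  have h2 := hz 1 le_rfl
  simp only [postJump, zd, delayedSample, Nat.cast_one, one_mul, hx1, one_ne_zero, if_false,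
    Matrix.mulVec_zero, zero_add, Pi.zero_apply, add_zero, Nat.one_lt_ofNat, dif_pos] at h1 h2
  exact ⟨h1, h2⟩

/-- If an entry of `Gc τ₀` were negative, a small bump of the delayed initial function passing
through the delay at timer value `τ₀` would drive a component of the state below zero. -/
theorem nonneg_Gc (hpos : S.InternallyPositive) {τ₀ : ℝ} (hτ₀ : 0 ≤ τ₀) (i j : Fin n) :
    0 ≤ S.Gc τ₀ i j := by
  by_contra! hneg
  set c : ℝ := -S.Gc τ₀ i j / 2 with hcdef
  have hc0 : 0 < c := by rw [hcdef]; linarith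
  have hIcc : Icc 0 (τ₀ + 1) ⊆ Ici (0 : ℝ) := Icc_subset_Ici_self
  obtain ⟨K₁, hK₁, hA⟩ := exists_norm_mulVec_le (S.continuousOn_A.mono hIcc)
  obtain ⟨K₂, hK₂, hG⟩ := exists_norm_mulVec_le (S.continuousOn_Gc.mono hIcc)
  set K := max K₁ K₂ with hK
  have hK0 : 0 ≤ K := hK₁.trans (le_max_left K₁ K₂)
  replace hA : ∀ τ ∈ Icc 0 (τ₀ + 1), ∀ v, ‖S.A τ *ᵥ v‖ ≤ K * ‖v‖ := fun τ hτ v =>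
    (hA τ hτ v).trans (by gcongr; exact le_max_left _ _)
  replace hG : ∀ τ ∈ Icc 0 (τ₀ + 1), ∀ v, ‖S.Gc τ *ᵥ v‖ ≤ K * ‖v‖ := fun τ hτ v =>
    (hG τ hτ v).trans (by gcongr; exact le_max_right _ _)
  set C : ℝ := K * (K * Real.exp (K * (τ₀ + 1))) with hC
  have hC0 : 0 ≤ C := by positivity
  -- On `[τ₀, τ₀ + r]` the contribution of `A` is at most `r * C` times the mass of the bump, which
  -- is less than the negative contribution of `Gc` once `r * C < c`.
  obtain ⟨r, hr0, hr1, hrc, hrG⟩ : ∃ r, 0 < r ∧ r < 1 ∧ r * C < c ∧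
      ∀ τ ∈ Icc τ₀ (τ₀ + r), S.Gc τ i j ≤ -c := by
    have hcw : ContinuousWithinAt (fun τ => S.Gc τ i j) (Ici 0) τ₀ :=
      ((continuous_id.matrix_elem i j).comp_continuousOn S.continuousOn_Gc) τ₀ hτ₀
    have hev := hcw.eventually (gt_mem_nhds (show S.Gc τ₀ i j < -c by rw [hcdef]; linarith))
    rw [eventually_nhdsWithin_iff, Metric.eventually_nhds_iff] at hev
    obtain ⟨d, hd, hdG⟩ := hev
    refine ⟨min (d / 2) (min (1 / 2) (c / (2 * (C + 1)))), by positivity, ?_, ?_, ?_⟩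
    · exact (min_le_right _ _).trans_lt ((min_le_left _ _).trans_lt (by norm_num))
    · calc _ ≤ c / (2 * (C + 1)) * C := by
            gcongr
            exact (min_le_right _ _).trans (min_le_right _ _)
        _ < c := by
            rw [div_mul_eq_mul_div, div_lt_iff₀ (by positivity)]
            nlinarith
    · intro τ hτ
      refine (hdG (y := τ) ?_ (hτ₀.trans hτ.1)).le
      have := min_le_left (d / 2) (min (1 / 2) (c / (2 * (C + 1))))
      rw [Real.dist_eq, abs_of_nonneg (sub_nonneg.2 hτ.1)]
      linarith [hτ.2]
  -- With this delay the delayed state on `[0, τ₀ + 1]` is the initial function, which has to vanish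
  -- at time `0` for the state to start at zero; this is why `θ` vanishes at `τ₀ + 1`.
  set hc : ℝ := τ₀ + 1 with hhc
  have hhc0 : 0 < hc := by linarith
  set θ : ℝ → ℝ := fun τ => max 0 ((τ - τ₀) * (τ₀ + 1 - τ)) with hθ
  have hθc : Continuous θ := by fun_prop
  have hθ0 : ∀ τ, 0 ≤ θ τ := fun τ => le_max_left _ _
  have hθz : ∀ τ ≤ τ₀, θ τ = 0 := fun τ hτ =>
    max_eq_left (mul_nonpos_of_nonpos_of_nonneg (by linarith) (by linarith))
  let φ : C(Icc (-hc) (0 : ℝ), Fin n → ℝ) :=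
    ⟨fun s => Pi.single j (θ (s + hc)), by
      refine (continuous_single j).comp (hθc.comp (by fun_prop))⟩
  have ht := isImpulseSequence_mul (c := τ₀ + 2) (by linarith)
  obtain ⟨x, hx⟩ := S.exists_isSolution hhc0.le 0 ht φ Fin.elim0 (wc := 0)
    (locallyIntegrableOn_const 0) 0
  obtain ⟨hx0, -, -⟩ := hpos hc 0 _ hhc0 ht _ _ _ _ _ (fun s => Pi.single_nonneg.2 (hθ0 _))
    (fun q => q.elim0) (locallyIntegrableOn_const 0) (fun _ _ => le_rfl) (fun _ _ => le_rfl) hx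
  have hist : ∀ τ ∈ Icc 0 hc, x (τ - hc) = Pi.single j (θ τ) := by
    intro τ hτ
    have := hx.history ⟨τ - hc, by linarith [hτ.1], by linarith [hτ.2]⟩
    simpa [φ] using this
  have hxz : x 0 = 0 := by
    have := hist hc ⟨hhc0.le, le_rfl⟩
    rw [sub_self] at this
    rw [this, show θ hc = 0 by simp [hθ, hhc], Pi.single_zero]
  have hnorm : ∀ τ ∈ Icc 0 hc, ‖x (τ - hc)‖ = θ τ := by
    intro τ hτ
    rw [hist τ hτ, Pi.norm_single, Real.norm_of_nonneg (hθ0 τ)]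
  have hbound : ∀ R ∈ Icc 0 hc, ∀ τ ∈ Icc 0 R,
      ‖x τ‖ ≤ (K * ∫ s in (0 : ℝ)..R, θ s) * Real.exp (K * τ) := by
    intro R hR τ hτ
    have hsub : Icc 0 R ⊆ Icc 0 (τ₀ + 1) := Icc_subset_Icc_right hR.2
    have := hx.norm_le_first hhc0.le ht hxz hR.1 (by simp; linarith [hR.2]) hK0
      (fun τ hτ => hA τ (hsub hτ)) (fun τ hτ => hG τ (hsub hτ)) τ hτ
    rwa [intervalIntegral.integral_congr (g := θ) fun s hs => by
      rw [uIcc_of_le hR.1] at hs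
      exact hnorm s (hsub hs)] at this
  have hR : τ₀ + r ∈ Icc 0 hc := ⟨by linarith, by linarith⟩
  have hzero : ∫ s in (0 : ℝ)..τ₀, θ s = 0 := by
    refine (intervalIntegral.integral_congr (g := fun _ => (0 : ℝ)) fun s hs => ?_).trans (by simp)
    rw [uIcc_of_le hτ₀] at hs
    exact hθz s hs.2
  have hxτ₀ : x τ₀ = 0 := by
    have := hbound τ₀ ⟨hτ₀, by linarith⟩ τ₀ ⟨hτ₀, le_rfl⟩
    rw [hzero, mul_zero, zero_mul] at this
    exact norm_le_zero_iff.1 this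
  set Θ : ℝ := ∫ s in τ₀..(τ₀ + r), θ s with hΘ
  have hΘ' : ∫ s in (0 : ℝ)..(τ₀ + r), θ s = Θ := by
    rw [← intervalIntegral.integral_add_adjacent_intervals (hθc.intervalIntegrable 0 τ₀)
      (hθc.intervalIntegrable τ₀ (τ₀ + r)), hzero, zero_add]
  have hΘ0 : 0 < Θ := by
    refine intervalIntegral.intervalIntegral_pos_of_pos_on (hθc.intervalIntegrable _ _) ?_
      (by linarith)
    intro s hs
    exact lt_max_of_lt_right (mul_pos (by linarith [hs.1]) (by linarith [hs.2]))
  have ht1 : τ₀ + r ≤ ((1 : ℕ) : ℝ) * (τ₀ + 2) := by push_cast; linarith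
  have hfi : IntervalIntegrable (S.flowField hc 0 0 x) volume 0 (τ₀ + 2) := by
    simpa using hx.integrable 0
  have hf1 : IntervalIntegrable (S.flowField hc 0 0 x) volume 0 τ₀ :=
    hfi.mono_set (by rw [uIcc_of_le hτ₀, uIcc_of_le (by linarith)]
                     exact Icc_subset_Icc_right (by linarith))
  have hf2 : IntervalIntegrable (S.flowField hc 0 0 x) volume τ₀ (τ₀ + r) :=
    hfi.mono_set (by rw [uIcc_of_le (by linarith), uIcc_of_le (by linarith)]
                     exact Icc_subset_Icc hτ₀ (by linarith))
  have hxr : x (τ₀ + r) = ∫ s in τ₀..(τ₀ + r), S.flowField hc 0 0 x s := by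
    have e1 := hx.eq_integral_first ht hxz ⟨hR.1, ht1⟩
    have e2 := hx.eq_integral_first ht hxz (τ := τ₀) ⟨hτ₀, by linarith⟩
    rw [e1, ← intervalIntegral.integral_add_adjacent_intervals hf1 hf2, ← e2, hxτ₀, zero_add]
  have hxri : x (τ₀ + r) i = ∫ s in τ₀..(τ₀ + r), S.flowField hc 0 0 x s i := by
    rw [hxr]
    exact ((ContinuousLinearMap.proj (R := ℝ) i :
      (Fin n → ℝ) →L[ℝ] ℝ).intervalIntegral_comp_comm hf2).symm
  have hle : x (τ₀ + r) i ≤ ∫ s in τ₀..(τ₀ + r), (C * Θ - c * θ s) := by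
    rw [hxri]
    refine intervalIntegral.integral_mono_on (by linarith) ?_
      (Continuous.intervalIntegrable (by fun_prop) _ _) fun s hs => ?_
    · rw [intervalIntegrable_iff] at hf2 ⊢
      rw [IntegrableOn, integrable_pi_iff] at hf2
      exact hf2 i
    · have hs' : s ∈ Icc 0 hc := ⟨hτ₀.trans hs.1, hs.2.trans hR.2⟩
      have h1 : (S.A s *ᵥ x s) i ≤ C * Θ := by
        refine (le_abs_self _).trans ((norm_le_pi_norm (S.A s *ᵥ x s) i).trans ?_)
        refine (hA s hs' _).trans ?_
        have := hbound (τ₀ + r) hR s ⟨hs'.1, hs.2⟩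
        rw [hΘ'] at this
        calc K * ‖x s‖ ≤ K * ((K * Θ) * Real.exp (K * s)) := by gcongr
          _ ≤ K * ((K * Θ) * Real.exp (K * (τ₀ + 1))) := by
              have := hs'.2
              gcongr
          _ = C * Θ := by rw [hC]; ring
      have h2 : (S.Gc s *ᵥ x (s - hc)) i ≤ -c * θ s := by
        rw [hist s hs', Matrix.mulVec_single]
        change S.Gc s i j * θ s ≤ _
        exact mul_le_mul_of_nonneg_right (hrG s hs) (hθ0 s)
      simp only [flowField, zero_add, Pi.zero_apply, Matrix.mulVec_zero, add_zero, Pi.add_apply]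
      linarith
  have heq : ∫ s in τ₀..(τ₀ + r), (C * Θ - c * θ s) = r * C * Θ - c * Θ := by
    rw [intervalIntegral.integral_sub intervalIntegrable_const
      ((hθc.intervalIntegrable _ _).const_mul c), intervalIntegral.integral_const_mul c,
      intervalIntegral.integral_const]
    simp only [add_sub_cancel_left, smul_eq_mul]
    ring
  have h1 := hx0 (τ₀ + r) hR.1 i
  have h2 := mul_lt_mul_of_pos_right hrc hΘ0
  rw [heq] at hle
  simp only [Pi.zero_apply] at h1
  linarith

end InternallyPositive

end ImpulsiveDelaySystem

/-! ### The dissipation inequality -/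

theorem IntervalIntegrable.dotProduct {m : ℕ} (v : Fin m → ℝ) {y : ℝ → Fin m → ℝ} {a b : ℝ}
    (hy : IntervalIntegrable y volume a b) :
    IntervalIntegrable (fun s => v ⬝ᵥ y s) volume a b := by
  rw [intervalIntegrable_iff] at hy ⊢
  rw [IntegrableOn, integrable_pi_iff] at hy
  exact integrable_finsetSum _ fun i _ => (hy i).const_mul (v i)

theorem dotProduct_le_vecL1_mul {m : ℕ} (v y : Fin m → ℝ) {N : ℝ} (hy : ‖y‖ ≤ N) :
    v ⬝ᵥ y ≤ vecL1 v * N := by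
  rw [vecL1, Finset.sum_mul]
  refine Finset.sum_le_sum fun i _ => (le_abs_self _).trans ?_
  rw [abs_mul]
  exact mul_le_mul_of_nonneg_left ((norm_le_pi_norm y i).trans hy) (abs_nonneg _)

namespace ImpulsiveDelaySystem

variable {n pc pd qc qd : ℕ} (S : ImpulsiveDelaySystem n pc pd qc qd)

/-- A linear copositive Lyapunov certificate with slack `c` for the dwell time `Tbar`: the
costate `p` (with derivative `p'`) on `[0, Tbar]`, kept constant afterwards, and the weight `μ` of
the continuous delay satisfy the flow inequalities, the jump inequality, and the sign conditions
that make the Lyapunov functional nonnegative on nonnegative solutions. -/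
structure IsCertificate (Tbar : ℝ) (p p' : ℝ → Fin n → ℝ) (μ : Fin n → ℝ) (c : ℝ) : Prop where
  hasDeriv : ∀ τ ∈ Icc 0 Tbar, HasDerivWithinAt p (p' τ) (Icc 0 Tbar) τ
  flow : ∀ τ ∈ Icc 0 Tbar, p' τ + p τ ᵥ* S.A τ + μ + 1 ᵥ* S.Cc ≤ fun _ => -c
  delay : ∀ τ ∈ Icc 0 Tbar, p τ ᵥ* S.Gc τ - μ + 1 ᵥ* S.Hc ≤ 0
  flow_top : ∀ τ, Tbar ≤ τ → p Tbar ᵥ* S.A τ + μ + 1 ᵥ* S.Cc ≤ fun _ => -c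
  delay_top : ∀ τ, Tbar ≤ τ → p Tbar ᵥ* S.Gc τ - μ + 1 ᵥ* S.Hc ≤ 0
  jump : -p Tbar + p 0 ᵥ* (S.J + S.Gd) + 1 ᵥ* (S.Cd + S.Hd) ≤ fun _ => -c
  top_nonneg : 0 ≤ p Tbar
  weight_nonneg : 0 ≤ μ
  memory_nonneg : 0 ≤ p 0 ᵥ* S.Gd + 1 ᵥ* S.Hd

/-- The part of the Lyapunov functional that stores the samples still to enter a jump through the
discrete delay. -/
def memory (p0 : Fin n → ℝ) (hd : ℕ) (t : ℕ → ℝ) (ψ : Fin hd → Fin n → ℝ) (x : ℝ → Fin n → ℝ)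
    (k : ℕ) : ℝ :=
  ∑ j ∈ Finset.range hd, (p0 ᵥ* S.Gd + 1 ᵥ* S.Hd) ⬝ᵥ delayedSample hd t ψ x (k + j)

variable {S} {hc : ℝ} {hd : ℕ} {t : ℕ → ℝ} {φ : C(Icc (-hc) (0 : ℝ), Fin n → ℝ)}
  {ψ : Fin hd → Fin n → ℝ} {wc : ℝ → Fin pc → ℝ} {wd : ℕ → Fin pd → ℝ} {x : ℝ → Fin n → ℝ}
  {Tbar c γ : ℝ} {p p' : ℝ → Fin n → ℝ} {μ : Fin n → ℝ}

namespace IsSolution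

theorem intervalIntegrable_delayed (hx : S.IsSolution hc hd t φ ψ wc wd x) (hhc : 0 ≤ hc)
    (ht : IsImpulseSequence t) {a b : ℝ} (ha : 0 ≤ a) (hb : 0 ≤ b) :
    IntervalIntegrable (fun s => x (s - hc)) volume a b := by
  have := (hx.intervalIntegrable hhc ht (a := a - hc) (b := b - hc)
    (by linarith) (by linarith)).comp_sub_right hc
  simpa using this

theorem intervalIntegrable_zc (hx : S.IsSolution hc hd t φ ψ wc wd x) (hhc : 0 ≤ hc)
    (ht : IsImpulseSequence t) {a b : ℝ} (ha : 0 ≤ a) (hb : 0 ≤ b)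
    (hw : IntervalIntegrable wc volume a b) :
    IntervalIntegrable (S.zc hc wc x) volume a b :=
  (((hx.intervalIntegrable hhc ht (by linarith) (by linarith)).mulVec continuousOn_const).add
    ((hx.intervalIntegrable_delayed hhc ht ha hb).mulVec continuousOn_const)).add
    (hw.mulVec continuousOn_const)

/-- The linear functional `p τ ⬝ᵥ x` dissipates along the flow, up to the exchange between the
present and the delayed state that is accounted for by `μ`. -/
theorem flow_dissipation (hx : S.IsSolution hc hd t φ ψ wc wd x) (hhc : 0 ≤ hc)
    (ht : IsImpulseSequence t) (hx0 : ∀ s, -hc ≤ s → 0 ≤ x s) {k : ℕ} {a b : ℝ} (ha : 0 ≤ a)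
    (hab : a ≤ b) (hb : b ≤ t (k + 1) - t k)
    (hw : IntervalIntegrable wc volume (t k + a) (t k + b))
    (hp : ∀ τ ∈ Icc a b, HasDerivWithinAt p (p' τ) (Icc a b) τ)
    (hX : ∀ τ ∈ Icc a b, p' τ + p τ ᵥ* S.A τ + μ + 1 ᵥ* S.Cc ≤ fun _ => -c)
    (hH : ∀ τ ∈ Icc a b, p τ ᵥ* S.Gc τ - μ + 1 ᵥ* S.Hc ≤ 0)
    (hW : ∀ τ ∈ Icc a b, (p τ ᵥ* S.Ec τ + 1 ᵥ* S.Fc) ⬝ᵥ wc (t k + τ) ≤ γ * (1 ⬝ᵥ wc (t k + τ))) :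
    p b ⬝ᵥ S.flowCurve hc hd t ψ wc wd x k b +
        ∫ s in (t k + a)..(t k + b), (1 ⬝ᵥ S.zc hc wc x s + c * (1 ⬝ᵥ x s) + μ ⬝ᵥ x s) ≤
      p a ⬝ᵥ S.flowCurve hc hd t ψ wc wd x k a +
        ∫ s in (t k + a)..(t k + b), (μ ⬝ᵥ x (s - hc) + γ * (1 ⬝ᵥ wc s)) := by
  set ξ := S.flowCurve hc hd t ψ wc wd x k with hξ
  set f := S.flowField hc (t k) wc x with hf
  have hu : uIcc a b = Icc a b := uIcc_of_le hab
  have htk := ht.nonneg k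
  have hA : ContinuousOn S.A (Icc a b) := S.continuousOn_A.mono fun s hs => ha.trans hs.1
  have hpc : ContinuousOn p (Icc a b) := fun τ hτ => (hp τ hτ).continuousWithinAt
  set g : ℝ → Fin n → ℝ := fun τ => -(p τ ᵥ* S.A τ + μ + 1 ᵥ* S.Cc) - fun _ => c with hg
  have hgc : ContinuousOn g (Icc a b) := by
    refine ContinuousOn.sub (ContinuousOn.neg ?_) continuousOn_const
    refine (ContinuousOn.add ?_ continuousOn_const).add continuousOn_const
    exact (continuous_fst.matrix_vecMul continuous_snd).comp_continuousOn (hpc.prodMk hA)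
  have hfi : ∀ s r, s ∈ Icc 0 (t (k + 1) - t k) → r ∈ Icc 0 (t (k + 1) - t k) →
      IntervalIntegrable f volume s r := by
    intro s r hs hr
    refine (hx.integrable k).mono_set ?_
    rw [uIcc_of_le (hs.1.trans hs.2)]
    exact uIcc_subset_Icc hs hr
  have haI : a ∈ Icc 0 (t (k + 1) - t k) := ⟨ha, hab.trans hb⟩
  have hbI : b ∈ Icc 0 (t (k + 1) - t k) := ⟨ha.trans hab, hb⟩
  have h0I : (0 : ℝ) ∈ Icc 0 (t (k + 1) - t k) := ⟨le_rfl, haI.1.trans haI.2⟩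
  have hξint : ∀ τ ∈ Icc a b, ∀ i, ξ τ i = ξ a i + ∫ s in a..τ, f s i := by
    intro τ hτ i
    have hτI : τ ∈ Icc 0 (t (k + 1) - t k) := ⟨ha.trans hτ.1, hτ.2.trans hb⟩
    have e1 : ξ τ = ξ a + ∫ s in a..τ, f s := by
      simp only [hξ, flowCurve, add_assoc]
      rw [intervalIntegral.integral_add_adjacent_intervals (hfi _ _ h0I haI) (hfi _ _ haI hτI)]
    rw [e1, Pi.add_apply]
    congr 1
    exact ((ContinuousLinearMap.proj (R := ℝ) i :
      (Fin n → ℝ) →L[ℝ] ℝ).intervalIntegral_comp_comm (hfi _ _ haI hτI)).symm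
  have hfii : ∀ i, IntervalIntegrable (fun s => f s i) volume a b := by
    intro i
    have := hfi a b haI hbI
    rw [intervalIntegrable_iff] at this ⊢
    rw [IntegrableOn, integrable_pi_iff] at this
    exact this i
  have hξ0 : ∀ τ ∈ Icc a b, ∀ i, 0 ≤ ξ τ i := fun τ hτ i =>
    hx.flowCurve_nonneg ht (fun s hs => hx0 s (by linarith)) k ⟨ha.trans hτ.1, hτ.2.trans hb⟩ i
  have hξc : ContinuousOn ξ (Icc a b) :=
    (hx.continuousOn_flowCurve ht k).mono (Icc_subset_Icc ha hb)
  have hint : ∀ i, IntervalIntegrable (fun τ => g τ i * ξ τ i + p τ i * f τ i) volume a b := by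
    intro i
    refine IntervalIntegrable.add (ContinuousOn.intervalIntegrable ?_) ((hfii i).continuousOn_mul ?_)
    · rw [hu]
      exact ((continuous_apply i).comp_continuousOn hgc).mul
        ((continuous_apply i).comp_continuousOn hξc)
    · rw [hu]; exact (continuous_apply i).comp_continuousOn hpc
  have hsum : p b ⬝ᵥ ξ b - p a ⬝ᵥ ξ a ≤
      ∫ τ in a..b, ∑ i, (g τ i * ξ τ i + p τ i * f τ i) := by
    rw [intervalIntegral.integral_finsetSum fun i _ => hint i]
    simp only [dotProduct, ← Finset.sum_sub_distrib]
    refine Finset.sum_le_sum fun i _ => mul_sub_mul_le_integral (p' := fun τ => p' τ i) hab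
      (fun τ hτ => (hasDerivWithinAt_pi.1 (hp τ hτ)) i)
      ((continuous_apply i).comp_continuousOn hgc) (fun τ hτ => ?_) (hfii i)
      (fun τ hτ => hξint τ hτ i) (fun τ hτ => hξ0 τ hτ i)
    have := hX τ hτ i
    simp only [hg, Function.comp_apply, Pi.add_apply, Pi.sub_apply, Pi.neg_apply] at this ⊢
    linarith
  set R₁ : ℝ → ℝ := fun s => 1 ⬝ᵥ S.zc hc wc x s + c * (1 ⬝ᵥ x s) + μ ⬝ᵥ x s with hR₁
  set R₂ : ℝ → ℝ := fun s => μ ⬝ᵥ x (s - hc) + γ * (1 ⬝ᵥ wc s) with hR₂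
  have hta : 0 ≤ t k + a := by linarith
  have htb : 0 ≤ t k + b := by linarith
  have hxi : IntervalIntegrable x volume (t k + a) (t k + b) :=
    hx.intervalIntegrable hhc ht (by linarith) (by linarith)
  have hR₁i : IntervalIntegrable R₁ volume (t k + a) (t k + b) :=
    (((hx.intervalIntegrable_zc hhc ht hta htb hw).dotProduct 1).add
      ((hxi.dotProduct 1).const_mul c)).add (hxi.dotProduct μ)
  have hR₂i : IntervalIntegrable R₂ volume (t k + a) (t k + b) :=
    ((hx.intervalIntegrable_delayed hhc ht hta htb).dotProduct μ).add
      ((hw.dotProduct 1).const_mul γ)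
  have hpt : ∫ τ in a..b, ∑ i, (g τ i * ξ τ i + p τ i * f τ i) ≤
      ∫ τ in a..b, (R₂ (t k + τ) - R₁ (t k + τ)) := by
    refine intervalIntegral.integral_mono_on_of_le_Ioo hab ?_ ?_ fun τ hτ => ?_
    · have := IntervalIntegrable.sum Finset.univ (f := fun i τ => g τ i * ξ τ i + p τ i * f τ i)
        fun i _ => hint i
      simpa [Finset.sum_fn] using this
    · simpa using (hR₂i.sub hR₁i).comp_add_left (t k)
    · have hτ' : τ ∈ Icc a b := Ioo_subset_Icc_self hτ
      have hxτ : x (t k + τ) = ξ τ :=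
        hx.flow k τ ⟨ha.trans_lt hτ.1, hτ.2.le.trans hb⟩
      have e1 : ∑ i, (g τ i * ξ τ i + p τ i * f τ i) = g τ ⬝ᵥ ξ τ + p τ ⬝ᵥ f τ :=
        Finset.sum_add_distrib
      have e2 : (fun _ : Fin n => c) ⬝ᵥ ξ τ = c * (1 ⬝ᵥ ξ τ) := by
        simp [dotProduct, Finset.mul_sum]
      have hd0 : 0 ≤ x (t k + τ - hc) := hx0 _ (by linarith [hτ.1])
      have hH' := dotProduct_le_dotProduct_of_nonneg_right (hH τ hτ') hd0
      have hW' := hW τ hτ'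
      rw [e1]
      simp only [hg, hf, hR₁, hR₂, flowField, zc, sub_dotProduct, neg_dotProduct, add_dotProduct,
        dotProduct_add, Matrix.dotProduct_mulVec, e2, hxτ, zero_dotProduct] at hH' hW' ⊢
      linarith
  rw [intervalIntegral.integral_comp_add_left (fun s => R₂ s - R₁ s),
    intervalIntegral.integral_sub hR₂i hR₁i] at hpt
  linarith

/-- Dissipation over a full dwell interval. The costate ends at `p Tbar` because the dwell time is at
least `Tbar`; the delay window `∫ μ ⬝ᵥ x` absorbs the exchange between present and delayed state. -/
theorem interval_dissipation (hx : S.IsSolution hc hd t φ ψ wc wd x) (hhc : 0 ≤ hc)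
    (ht : IsImpulseSequence t) (hx0 : ∀ s, -hc ≤ s → 0 ≤ x s) (hT : 0 ≤ Tbar)
    (hcert : S.IsCertificate Tbar p p' μ c) {k : ℕ} (hk : Tbar ≤ t (k + 1) - t k)
    (hw : IntervalIntegrable wc volume (t k) (t (k + 1)))
    (hW : ∀ τ, 0 ≤ τ → (p (min τ Tbar) ᵥ* S.Ec τ + 1 ᵥ* S.Fc) ⬝ᵥ wc (t k + τ) ≤
      γ * (1 ⬝ᵥ wc (t k + τ))) :
    p Tbar ⬝ᵥ x (t (k + 1)) + (∫ s in (t (k + 1) - hc)..(t (k + 1)), μ ⬝ᵥ x s) +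
        ∫ s in (t k)..(t (k + 1)), (1 ⬝ᵥ S.zc hc wc x s + c * (1 ⬝ᵥ x s)) ≤
      p 0 ⬝ᵥ S.postJump hd t ψ wd x k + (∫ s in (t k - hc)..(t k), μ ⬝ᵥ x s) +
        γ * ∫ s in (t k)..(t (k + 1)), 1 ⬝ᵥ wc s := by
  have htk := ht.nonneg k
  have htk1 := ht.nonneg (k + 1)
  have hmem : t k + Tbar ∈ uIcc (t k) (t (k + 1)) := by
    rw [uIcc_of_le (by linarith)]; exact ⟨by linarith, by linarith⟩
  have hw1 : IntervalIntegrable wc volume (t k) (t k + Tbar) :=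
    hw.mono_set (uIcc_subset_uIcc left_mem_uIcc hmem)
  have hw2 : IntervalIntegrable wc volume (t k + Tbar) (t (k + 1)) :=
    hw.mono_set (uIcc_subset_uIcc hmem right_mem_uIcc)
  have h1 := hx.flow_dissipation hhc ht hx0 (k := k) (a := 0) (b := Tbar) (γ := γ) le_rfl hT hk
    (by simpa using hw1) hcert.hasDeriv hcert.flow hcert.delay
    (fun τ hτ => by simpa [min_eq_left hτ.2] using hW τ hτ.1)
  have h2 := hx.flow_dissipation hhc ht hx0 (k := k) (a := Tbar) (b := t (k + 1) - t k) (γ := γ)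
    (p := fun _ => p Tbar) (p' := fun _ => 0) hT hk le_rfl
    (by simpa using hw2) (fun τ _ => hasDerivWithinAt_const _ _ _)
    (fun τ hτ => by simpa using hcert.flow_top τ hτ.1) (fun τ hτ => hcert.delay_top τ hτ.1)
    (fun τ hτ => by simpa [min_eq_right hτ.1] using hW τ (hT.trans hτ.1))
  have e : S.flowCurve hc hd t ψ wc wd x k (t (k + 1) - t k) = x (t (k + 1)) :=
    (hx.eq_flowCurve ⟨ht.lt_succ k, le_rfl⟩).symm
  rw [e, add_sub_cancel] at h2
  rw [flowCurve_zero, add_zero] at h1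
  have hxi : ∀ a b, -hc ≤ a → -hc ≤ b → IntervalIntegrable x volume a b :=
    fun a b ha hb => hx.intervalIntegrable hhc ht ha hb
  have hR₁ : ∀ a b, 0 ≤ a → 0 ≤ b → IntervalIntegrable wc volume a b →
      IntervalIntegrable (fun s => 1 ⬝ᵥ S.zc hc wc x s + c * (1 ⬝ᵥ x s)) volume a b := by
    intro a b ha hb hwab
    exact ((hx.intervalIntegrable_zc hhc ht ha hb hwab).dotProduct 1).add
      (((hxi a b (by linarith) (by linarith)).dotProduct 1).const_mul c)
  have hμx : ∀ a b, -hc ≤ a → -hc ≤ b → IntervalIntegrable (fun s => μ ⬝ᵥ x s) volume a b :=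
    fun a b ha hb => (hxi a b ha hb).dotProduct μ
  have hμd : ∀ a b, 0 ≤ a → 0 ≤ b → IntervalIntegrable (fun s => μ ⬝ᵥ x (s - hc)) volume a b :=
    fun a b ha hb => (hx.intervalIntegrable_delayed hhc ht ha hb).dotProduct μ
  have hmid : 0 ≤ t k + Tbar := by linarith
  rw [intervalIntegral.integral_add (hR₁ _ _ htk hmid hw1) (hμx _ _ (by linarith) (by linarith)),
    intervalIntegral.integral_add (hμd _ _ htk hmid) ((hw1.dotProduct 1).const_mul γ),
    intervalIntegral.integral_const_mul] at h1
  rw [intervalIntegral.integral_add (hR₁ _ _ hmid htk1 hw2) (hμx _ _ (by linarith) (by linarith)),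
    intervalIntegral.integral_add (hμd _ _ hmid htk1) ((hw2.dotProduct 1).const_mul γ),
    intervalIntegral.integral_const_mul] at h2
  have a1 := intervalIntegral.integral_add_adjacent_intervals (hR₁ _ _ htk hmid hw1)
    (hR₁ _ _ hmid htk1 hw2)
  have a2 := intervalIntegral.integral_add_adjacent_intervals
    (hμx (t k) (t k + Tbar) (by linarith) (by linarith))
    (hμx (t k + Tbar) (t (k + 1)) (by linarith) (by linarith))
  have a3 := intervalIntegral.integral_add_adjacent_intervals (hμd _ _ htk hmid)
    (hμd _ _ hmid htk1)
  have a4 := intervalIntegral.integral_add_adjacent_intervals (hw1.dotProduct 1)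
    (hw2.dotProduct 1)
  have a5 := intervalIntegral.integral_comp_sub_right (a := t k) (b := t (k + 1))
    (fun s => μ ⬝ᵥ x s) hc
  have a6 := intervalIntegral.integral_add_adjacent_intervals
    (hμx (t k - hc) (t k) (by linarith) (by linarith))
    (hμx (t k) (t (k + 1)) (by linarith) (by linarith))
  have a7 := intervalIntegral.integral_add_adjacent_intervals
    (hμx (t k - hc) (t (k + 1) - hc) (by linarith) (by linarith))
    (hμx (t (k + 1) - hc) (t (k + 1)) (by linarith) (by linarith))
  have a8 : γ * (∫ s in (t k)..(t (k + 1)), 1 ⬝ᵥ wc s) =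
      γ * (∫ s in (t k)..(t k + Tbar), 1 ⬝ᵥ wc s) +
      γ * ∫ s in (t k + Tbar)..(t (k + 1)), 1 ⬝ᵥ wc s := by rw [← a4, mul_add]
  linarith

end IsSolution

/-- Dissipation at a jump; the stored samples account for the discrete delay. -/
theorem IsCertificate.jump_dissipation (hcert : S.IsCertificate Tbar p p' μ c) {k : ℕ} (hk : 1 ≤ k)
    (hxk : 0 ≤ x (t k))
    (hW : (p 0 ᵥ* S.Ed + 1 ᵥ* S.Fd) ⬝ᵥ wd k ≤ γ * (1 ⬝ᵥ wd k)) :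
    p 0 ⬝ᵥ S.postJump hd t ψ wd x k + S.memory (p 0) hd t ψ x (k + 1) +
        (1 ⬝ᵥ S.zd hd t ψ wd x k + c * (1 ⬝ᵥ x (t k))) ≤
      p Tbar ⬝ᵥ x (t k) + S.memory (p 0) hd t ψ x k + γ * (1 ⬝ᵥ wd k) := by
  set m := p 0 ᵥ* S.Gd + 1 ᵥ* S.Hd with hm
  -- Passing from `k` to `k + 1` the memory drops the delayed sample and stores `x (t k)`.
  have hmem : S.memory (p 0) hd t ψ x (k + 1) + m ⬝ᵥ delayedSample hd t ψ x k =
      S.memory (p 0) hd t ψ x k + m ⬝ᵥ x (t k) := by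
    have h1 := Finset.sum_range_succ (fun j => m ⬝ᵥ delayedSample hd t ψ x (k + j)) hd
    have h2 := Finset.sum_range_succ' (fun j => m ⬝ᵥ delayedSample hd t ψ x (k + j)) hd
    have h3 : delayedSample hd t ψ x (k + hd) = x (t k) := by simp [delayedSample]
    rw [h1, h3] at h2
    simp only [memory, ← hm, h2, add_zero]
    congr 1
    exact Finset.sum_congr rfl fun j _ => by rw [add_right_comm, add_assoc]
  have hjump := dotProduct_le_dotProduct_of_nonneg_right hcert.jump hxk
  have e2 : (fun _ : Fin n => -c) ⬝ᵥ x (t k) = -(c * (1 ⬝ᵥ x (t k))) := by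
    simp [dotProduct, Finset.mul_sum]
  simp only [postJump, if_neg (Nat.one_le_iff_ne_zero.1 hk), zd, hm, neg_dotProduct,
    add_dotProduct, dotProduct_add, Matrix.dotProduct_mulVec, e2, Matrix.vecMul_add]
    at hmem hjump hW ⊢
  linarith

theorem IsCertificate.memory_functional_nonneg (hcert : S.IsCertificate Tbar p p' μ c) (ht : IsImpulseSequence t)
    (hx0 : ∀ s, 0 ≤ s → 0 ≤ x s) (hψ : ∀ j, 0 ≤ ψ j) (k : ℕ) :
    0 ≤ S.memory (p 0) hd t ψ x k := by
  refine Finset.sum_nonneg fun j _ => dotProduct_nonneg_of_nonneg hcert.memory_nonneg ?_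
  unfold delayedSample
  split_ifs with h
  · exact hψ _
  · exact hx0 _ (ht.nonneg _)

namespace IsSolution

/-- The dissipation inequality at the impulse times, summed over all intervals and jumps. -/
theorem total_dissipation (hx : S.IsSolution hc hd t φ ψ wc wd x) (hhc : 0 ≤ hc)
    (ht : IsImpulseSequence t) (hx0 : ∀ s, -hc ≤ s → 0 ≤ x s) (hT : 0 ≤ Tbar)
    (hdwell : HasMinDwellTime Tbar t)
    (hcert : S.IsCertificate Tbar p p' μ c) (hw : LocallyIntegrableOn wc (Ici 0))
    (hWc : ∀ τ s, 0 ≤ τ → 0 ≤ s → (p (min τ Tbar) ᵥ* S.Ec τ + 1 ᵥ* S.Fc) ⬝ᵥ wc s ≤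
      γ * (1 ⬝ᵥ wc s))
    (hWd : ∀ k, 1 ≤ k → (p 0 ᵥ* S.Ed + 1 ᵥ* S.Fd) ⬝ᵥ wd k ≤ γ * (1 ⬝ᵥ wd k)) (k : ℕ) :
    p Tbar ⬝ᵥ x (t (k + 1)) + (∫ s in (t (k + 1) - hc)..(t (k + 1)), μ ⬝ᵥ x s) +
        S.memory (p 0) hd t ψ x (k + 1) +
        (∫ s in (0 : ℝ)..(t (k + 1)), (1 ⬝ᵥ S.zc hc wc x s + c * (1 ⬝ᵥ x s))) +
        ∑ j ∈ Finset.range k, (1 ⬝ᵥ S.zd hd t ψ wd x (j + 1) + c * (1 ⬝ᵥ x (t (j + 1)))) ≤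
      p 0 ⬝ᵥ x 0 + (∫ s in (-hc)..0, μ ⬝ᵥ x s) + S.memory (p 0) hd t ψ x 1 +
        γ * ((∫ s in (0 : ℝ)..(t (k + 1)), 1 ⬝ᵥ wc s) +
          ∑ j ∈ Finset.range k, 1 ⬝ᵥ wd (j + 1)) := by
  have hwi : ∀ k, IntervalIntegrable wc volume (t k) (t (k + 1)) := fun k =>
    hw.intervalIntegrable_Ici (ht.nonneg k) (ht.nonneg _)
  have hint := fun k => hx.interval_dissipation hhc ht hx0 hT hcert (hdwell k) (hwi k)
    (fun τ hτ => hWc τ _ hτ (add_nonneg (ht.nonneg k) hτ))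
  induction k with
  | zero =>
    have h := hint 0
    simp only [ht.zero, zero_add, postJump, if_true, zero_sub] at h
    simp only [zero_add, Finset.range_zero, Finset.sum_empty, add_zero]
    linarith
  | succ k ih =>
    have h := hint (k + 1)
    have hj := hcert.jump_dissipation (hd := hd) (t := t) (ψ := ψ) (x := x) (γ := γ) (Nat.le_add_left 1 k)
      (hx0 _ (by linarith [ht.nonneg (k + 1)])) (hWd (k + 1) (Nat.le_add_left 1 k))
    rw [Finset.sum_range_succ, Finset.sum_range_succ]
    have hw0 : IntervalIntegrable wc volume 0 (t (k + 1)) :=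
      hw.intervalIntegrable_Ici le_rfl (ht.nonneg _)
    have hR : ∀ a b, 0 ≤ a → 0 ≤ b →
        IntervalIntegrable (fun s => 1 ⬝ᵥ S.zc hc wc x s + c * (1 ⬝ᵥ x s)) volume a b := by
      intro a b ha hb
      exact ((hx.intervalIntegrable_zc hhc ht ha hb (hw.intervalIntegrable_Ici ha hb)).dotProduct
        1).add (((hx.intervalIntegrable hhc ht (by linarith) (by linarith)).dotProduct
          1).const_mul c)
    have a1 := intervalIntegral.integral_add_adjacent_intervals (hw0.dotProduct 1)
      ((hwi (k + 1)).dotProduct 1)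
    have a2 := intervalIntegral.integral_add_adjacent_intervals
      (hR 0 (t (k + 1)) le_rfl (ht.nonneg _)) (hR (t (k + 1)) (t (k + 1 + 1)) (ht.nonneg _)
        (ht.nonneg _))
    rw [← a1, ← a2]
    linarith

/-- The initial value of the Lyapunov functional is controlled by the size of the initial data,
uniformly in the impulse times. -/
theorem initial_le (hx : S.IsSolution hc hd t φ ψ wc wd x) (hhc : 0 ≤ hc)
    (ht : IsImpulseSequence t) {N : ℝ} (hN : ‖(φ, ψ)‖ ≤ N) (p0 : Fin n → ℝ) :
    p0 ⬝ᵥ x 0 + (∫ s in (-hc)..0, μ ⬝ᵥ x s) + S.memory p0 hd t ψ x 1 ≤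
      (vecL1 p0 + hc * vecL1 μ + hd * vecL1 (p0 ᵥ* S.Gd + 1 ᵥ* S.Hd)) * N := by
  have hφN : ‖φ‖ ≤ N := (norm_fst_le (φ, ψ)).trans hN
  have hψN : ‖ψ‖ ≤ N := (norm_snd_le (φ, ψ)).trans hN
  have hhist : ∀ s ∈ Icc (-hc) 0, ‖x s‖ ≤ N := fun s hs => by
    have := hx.history ⟨s, hs⟩
    simp only at this
    rw [this]
    exact (φ.norm_coe_le_norm _).trans hφN
  have h0 : ‖x 0‖ ≤ N := hhist 0 ⟨by linarith, le_rfl⟩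
  have h1 := dotProduct_le_vecL1_mul p0 (x 0) h0
  have h2 : ∫ s in (-hc)..0, μ ⬝ᵥ x s ≤ ∫ _s in (-hc)..0, vecL1 μ * N := by
    refine intervalIntegral.integral_mono_on (by linarith)
      ((hx.intervalIntegrable hhc ht le_rfl (by linarith)).dotProduct μ)
      intervalIntegrable_const fun s hs => dotProduct_le_vecL1_mul μ _ (hhist s hs)
  rw [intervalIntegral.integral_const, smul_eq_mul, zero_sub, neg_neg] at h2
  have h3 : S.memory p0 hd t ψ x 1 ≤
      ∑ _j ∈ Finset.range hd, vecL1 (p0 ᵥ* S.Gd + 1 ᵥ* S.Hd) * N := by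
    refine Finset.sum_le_sum fun j hj => dotProduct_le_vecL1_mul _ _ ?_
    unfold delayedSample
    split_ifs with h
    · exact (norm_le_pi_norm ψ _).trans hψN
    · have : 1 + j - hd = 0 := by have := Finset.mem_range.1 hj; omega
      rw [this, ht.zero]
      exact h0
  rw [Finset.sum_const, Finset.card_range, nsmul_eq_mul] at h3
  linarith

/-- For nonnegative solutions the Lyapunov functional is nonnegative, so the accumulated outputs
and the accumulated slack are bounded by the initial data and the accumulated inputs. -/
theorem accumulated_le (hx : S.IsSolution hc hd t φ ψ wc wd x) (hhc : 0 ≤ hc)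
    (ht : IsImpulseSequence t) (hx0 : ∀ s, -hc ≤ s → 0 ≤ x s) (hψ : ∀ j, 0 ≤ ψ j)
    (hT : 0 ≤ Tbar) (hdwell : HasMinDwellTime Tbar t)
    (hcert : S.IsCertificate Tbar p p' μ c) (hw : LocallyIntegrableOn wc (Ici 0))
    (hWc : ∀ τ s, 0 ≤ τ → 0 ≤ s → (p (min τ Tbar) ᵥ* S.Ec τ + 1 ᵥ* S.Fc) ⬝ᵥ wc s ≤
      γ * (1 ⬝ᵥ wc s))
    (hWd : ∀ k, 1 ≤ k → (p 0 ᵥ* S.Ed + 1 ᵥ* S.Fd) ⬝ᵥ wd k ≤ γ * (1 ⬝ᵥ wd k))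
    {N : ℝ} (hN : ‖(φ, ψ)‖ ≤ N) (k : ℕ) :
    (∫ s in (0 : ℝ)..(t (k + 1)), (1 ⬝ᵥ S.zc hc wc x s + c * (1 ⬝ᵥ x s))) +
        ∑ j ∈ Finset.range k, (1 ⬝ᵥ S.zd hd t ψ wd x (j + 1) + c * (1 ⬝ᵥ x (t (j + 1)))) ≤
      (vecL1 (p 0) + hc * vecL1 μ + hd * vecL1 (p 0 ᵥ* S.Gd + 1 ᵥ* S.Hd)) * N +
        γ * ((∫ s in (0 : ℝ)..(t (k + 1)), 1 ⬝ᵥ wc s) +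
          ∑ j ∈ Finset.range k, 1 ⬝ᵥ wd (j + 1)) := by
  have h1 := hx.total_dissipation hhc ht hx0 hT hdwell hcert hw hWc hWd k
  have h2 := hx.initial_le (μ := μ) hhc ht hN (p 0)
  have htk := ht.nonneg (k + 1)
  have h3 : 0 ≤ p Tbar ⬝ᵥ x (t (k + 1)) :=
    dotProduct_nonneg_of_nonneg hcert.top_nonneg (hx0 _ (by linarith))
  have h4 : 0 ≤ ∫ s in (t (k + 1) - hc)..(t (k + 1)), μ ⬝ᵥ x s :=
    intervalIntegral.integral_nonneg (by linarith) fun s hs =>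
      dotProduct_nonneg_of_nonneg hcert.weight_nonneg (hx0 _ (by linarith [hs.1]))
  have h5 := hcert.memory_functional_nonneg (hd := hd) ht (fun s hs => hx0 s (by linarith)) hψ (k + 1)
  linarith

end IsSolution

end ImpulsiveDelaySystem

/-! ### Hybrid gain and asymptotic stability -/

theorem vecL1_eq_one_dotProduct_abs {m : ℕ} (v : Fin m → ℝ) : vecL1 v = 1 ⬝ᵥ |v| := by
  simp [vecL1, dotProduct]

theorem vecL1_nonneg {m : ℕ} (v : Fin m → ℝ) : 0 ≤ vecL1 v :=
  Finset.sum_nonneg fun _ _ => abs_nonneg _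

theorem norm_le_vecL1 {m : ℕ} (v : Fin m → ℝ) : ‖v‖ ≤ vecL1 v :=
  (pi_norm_le_iff_of_nonneg (vecL1_nonneg v)).2 fun i =>
    Finset.single_le_sum (f := fun i => |v i|) (fun _ _ => abs_nonneg _) (Finset.mem_univ i)

theorem vecL1_le_of_abs_le {m : ℕ} {v w : Fin m → ℝ} (h : |v| ≤ w) : vecL1 v ≤ 1 ⬝ᵥ w := by
  rw [vecL1_eq_one_dotProduct_abs]
  exact dotProduct_le_dotProduct_of_nonneg_left h zero_le_one

theorem MeasureTheory.Integrable.vecL1 {m : ℕ} {α : Type*} [MeasurableSpace α] {ν : Measure α}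
    {y : α → Fin m → ℝ} (hy : Integrable y ν) : Integrable (fun s => vecL1 (y s)) ν :=
  integrable_finsetSum _ fun i _ => (integrable_pi_iff.1 hy i).abs

theorem IsImpulseSequence.exists_mem_Ioc {t : ℕ → ℝ} (ht : IsImpulseSequence t) {m : ℕ} {s : ℝ}
    (hs : t m < s) : ∃ k, m ≤ k ∧ s ∈ Ioc (t k) (t (k + 1)) := by
  classical
  have hex : ∃ k, s ≤ t k := (ht.tendsto.eventually_ge_atTop s).exists
  obtain ⟨k, hk⟩ : ∃ k, Nat.find hex = k + 1 := by
    refine Nat.exists_eq_succ_of_ne_zero fun h => ?_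
    have := Nat.find_spec hex
    rw [h] at this
    linarith [ht.monotone (Nat.zero_le m)]
  have h1 : s ≤ t (k + 1) := hk ▸ Nat.find_spec hex
  have h2 : t k < s := not_le.1 (Nat.find_min hex (by omega))
  refine ⟨k, ?_, h2, h1⟩
  by_contra! h
  linarith [ht.monotone (Nat.succ_le_of_lt h)]

namespace ImpulsiveDelaySystem

variable {n pc pd qc qd : ℕ} {S : ImpulsiveDelaySystem n pc pd qc qd}
  {Tbar c γ : ℝ} {p p' : ℝ → Fin n → ℝ} {μ : Fin n → ℝ}

/-- The slack of the conditions at the top of the timer interval and at the jumps can be spread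
over the whole timer interval, by subtracting from the costate a small multiple of a function that
vanishes at `0` and grows faster than the flow can. -/
theorem IsCertificate.exists_pos_slack (hpos : S.InternallyPositive) {ε : ℝ} (hε : 0 < ε)
    (hT : 0 ≤ Tbar) (hA : ∀ τ, Tbar ≤ τ → S.A τ = S.A Tbar)
    (hG : ∀ τ, Tbar ≤ τ → S.Gc τ = S.Gc Tbar)
    (hcert : S.IsCertificate Tbar p p' μ 0) (hp : ∀ i, 0 < p Tbar i)
    (htop : p Tbar ᵥ* S.A Tbar + μ + 1 ᵥ* S.Cc ≤ fun _ => -ε)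
    (hjump : -p Tbar + p 0 ᵥ* (S.J + S.Gd) + 1 ᵥ* (S.Cd + S.Hd) ≤ fun _ => -ε) :
    ∃ (q q' : ℝ → Fin n → ℝ) (c : ℝ), 0 < c ∧ S.IsCertificate Tbar q q' μ c := by
  obtain ⟨K, hK⟩ : ∃ K, ∀ τ ∈ Icc 0 Tbar, ‖(1 : Fin n → ℝ) ᵥ* S.A τ‖ ≤ K :=
    isCompact_Icc.exists_bound_of_continuousOn
      ((continuous_const.matrix_vecMul continuous_id).comp_continuousOn
        (S.continuousOn_A.mono Icc_subset_Ici_self))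
  have hK0 : 0 ≤ K := (norm_nonneg _).trans (hK 0 ⟨le_rfl, hT⟩)
  replace hK : ∀ τ ∈ Icc 0 Tbar, ∀ i, -K ≤ ((1 : Fin n → ℝ) ᵥ* S.A τ) i := fun τ hτ i =>
    (abs_le.1 ((norm_le_pi_norm ((1 : Fin n → ℝ) ᵥ* S.A τ) i).trans (hK τ hτ))).1
  -- `f 0 = 0` keeps the jump inequality, and `1 + K * f ≤ f'` creates slack in the flow inequality.
  set f : ℝ → ℝ := fun τ => τ * Real.exp (K * τ) with hf
  set f' : ℝ → ℝ := fun τ => Real.exp (K * τ) + K * f τ with hf'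
  have hfd : ∀ τ, HasDerivAt f (f' τ) τ := by
    intro τ
    have h1 := (hasDerivAt_id τ).mul (((hasDerivAt_id τ).const_mul K).exp)
    refine h1.congr_deriv ?_
    simp only [hf', hf, id]
    ring
  have hf0 : ∀ τ, 0 ≤ τ → 0 ≤ f τ := fun τ hτ => mul_nonneg hτ (Real.exp_pos _).le
  have hfg : ∀ τ, 0 ≤ τ → 1 + K * f τ ≤ f' τ := fun τ hτ => by
    have : 1 ≤ Real.exp (K * τ) := Real.one_le_exp (mul_nonneg hK0 hτ)
    simp only [hf']; linarith
  obtain ⟨d, hd0, hd1, hd2, hd3⟩ : ∃ d : ℝ, 0 < d ∧ d * f Tbar < ε / 2 ∧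
      d * (f Tbar * K) < ε / 2 ∧ ∀ i, d * f Tbar < p Tbar i := by
    have hlim : ∀ m r : ℝ, 0 < r → ∀ᶠ d in 𝓝[>] (0 : ℝ), d * m < r := by
      intro m r hr
      have : Tendsto (fun d : ℝ => d * m) (𝓝[>] 0) (𝓝 (0 * m)) :=
        ((continuous_id.mul continuous_const).tendsto 0).mono_left nhdsWithin_le_nhds
      rw [zero_mul] at this
      exact this.eventually (gt_mem_nhds hr)
    have hd : ∀ᶠ d in 𝓝[>] (0 : ℝ), 0 < d := self_mem_nhdsWithin
    have := hd.and ((hlim (f Tbar) _ (half_pos hε)).and ((hlim (f Tbar * K) _ (half_pos hε)).and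
        (eventually_all.2 fun i => hlim (f Tbar) _ (hp i))))
    obtain ⟨d, h0, h1, h2, h3⟩ := this.exists
    exact ⟨d, h0, h1, h2, h3⟩
  set q : ℝ → Fin n → ℝ := fun τ => p τ - (d * f τ) • (1 : Fin n → ℝ) with hq
  have hq0 : q 0 = p 0 := by simp [hq, hf]
  have hmul : ∀ τ (M : Matrix (Fin n) (Fin n) ℝ) i, (q τ ᵥ* M) i =
      (p τ ᵥ* M) i - d * f τ * ((1 : Fin n → ℝ) ᵥ* M) i := by
    intro τ M i
    simp [hq, Matrix.sub_vecMul, Matrix.smul_vecMul]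
  have hG1 : ∀ τ, 0 ≤ τ → ∀ i, 0 ≤ ((1 : Fin n → ℝ) ᵥ* S.Gc τ) i := by
    intro τ hτ i
    exact dotProduct_nonneg_of_nonneg zero_le_one fun j => hpos.nonneg_Gc hτ j i
  have hdelay : ∀ τ ∈ Icc 0 Tbar, q τ ᵥ* S.Gc τ - μ + 1 ᵥ* S.Hc ≤ 0 := by
    intro τ hτ i
    have h1 := hcert.delay τ hτ i
    have h2 := mul_nonneg (mul_nonneg hd0.le (hf0 τ hτ.1)) (hG1 τ hτ.1 i)
    simp only [Pi.add_apply, Pi.sub_apply, Pi.zero_apply, hmul] at h1 ⊢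
    linarith
  refine ⟨q, fun τ => p' τ - (d * f' τ) • (1 : Fin n → ℝ), min d (ε / 2),
    lt_min hd0 (half_pos hε), ?_, ?_, hdelay, ?_, ?_, ?_, ?_, hcert.weight_nonneg, ?_⟩
  · intro τ hτ
    exact (hcert.hasDeriv τ hτ).sub
      (((hfd τ).const_mul d).hasDerivWithinAt.smul_const (1 : Fin n → ℝ))
  · intro τ hτ i
    have h1 := hcert.flow τ hτ i
    have h2 := mul_le_mul_of_nonneg_left (hK τ hτ i) (mul_nonneg hd0.le (hf0 τ hτ.1))
    have h3 := mul_le_mul_of_nonneg_left (hfg τ hτ.1) hd0.le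
    have h4 := min_le_left d (ε / 2)
    simp only [Pi.add_apply, Pi.sub_apply, Pi.smul_apply, Pi.one_apply, smul_eq_mul, hmul]
      at h1 ⊢
    linarith
  · intro τ hτ i
    rw [hA τ hτ]
    have h1 := htop i
    have h2 := mul_le_mul_of_nonneg_left (hK Tbar ⟨hT, le_rfl⟩ i)
      (mul_nonneg hd0.le (hf0 Tbar hT))
    have h4 := min_le_right d (ε / 2)
    simp only [Pi.add_apply, hmul] at h1 ⊢
    linarith
  · intro τ hτ
    rw [hG τ hτ]
    exact hdelay Tbar ⟨hT, le_rfl⟩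
  · intro i
    have h1 := hjump i
    have h4 := min_le_right d (ε / 2)
    rw [hq0]
    simp only [Pi.add_apply, Pi.neg_apply, hq, Pi.sub_apply, Pi.smul_apply, Pi.one_apply,
      smul_eq_mul] at h1 ⊢
    linarith
  · intro i
    have := hd3 i
    simp only [hq, Pi.zero_apply, Pi.sub_apply, Pi.smul_apply, Pi.one_apply, smul_eq_mul]
    linarith
  · rw [hq0]; exact hcert.memory_nonneg

/-- A certificate without slack already gives the gain bound, with an initial-data term that is
linear in the size of the data. -/
theorem IsCertificate.hasHybridGain (hcert : S.IsCertificate Tbar p p' μ 0)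
    (hpos : S.InternallyPositive) (hT : 0 ≤ Tbar) (hγ : 0 ≤ γ)
    (hWc : ∀ τ, 0 ≤ τ → p (min τ Tbar) ᵥ* S.Ec τ + 1 ᵥ* S.Fc ≤ fun _ => γ)
    (hWd : p 0 ᵥ* S.Ed + 1 ᵥ* S.Fd ≤ fun _ => γ) {hc : ℝ} (hhc : 0 < hc) (hd : ℕ) :
    S.HasHybridGain hc hd Tbar γ := by
  set C : ℝ := vecL1 (p 0) + hc * vecL1 μ + hd * vecL1 (p 0 ᵥ* S.Gd + 1 ᵥ* S.Hd) with hC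
  have hC0 : 0 ≤ C := by
    have := vecL1_nonneg (p 0)
    have := vecL1_nonneg μ
    have := vecL1_nonneg (p 0 ᵥ* S.Gd + 1 ᵥ* S.Hd)
    positivity
  have hC1 : 0 < C + 1 := by linarith
  have hγdot : ∀ {m : ℕ} (w : Fin m → ℝ), (fun _ : Fin m => γ) ⬝ᵥ w = γ * (1 ⬝ᵥ w) := by
    intro m w
    simp [dotProduct, Finset.mul_sum]
  -- `C` may vanish, whereas the bounding function has to be strictly increasing.
  refine ⟨fun s => (C + 1) * s, fun a _ b _ hab => mul_lt_mul_of_pos_left hab hC1, mul_zero _,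
    tendsto_id.const_mul_atTop hC1, ?_⟩
  intro t ht hdwell φ ψ wc wd x hwc hwd hx
  have hwl : LocallyIntegrableOn wc (Ici 0) :=
    ((integrableOn_Ici_iff_integrableOn_Ioi).2 hwc).locallyIntegrableOn
  obtain ⟨X, hX, hxX, hzc, hzd⟩ := hpos.exists_majorant hhc ht hwl hx
  have hX0 : ∀ s, -hc ≤ s → 0 ≤ X s := fun s hs => (abs_nonneg (x s)).trans (hxX s hs)
  have hwl' : LocallyIntegrableOn |wc| (Ici 0) := hwl.abs_pi
  have hacc := hX.accumulated_le (N := ‖(φ, ψ)‖) hhc.le ht hX0 (fun j => abs_nonneg (ψ j)) hT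
    hdwell hcert hwl'
    (fun τ s hτ _ => (dotProduct_le_dotProduct_of_nonneg_right (hWc τ hτ)
      (abs_nonneg (wc s))).trans_eq (hγdot _))
    (fun k _ => (dotProduct_le_dotProduct_of_nonneg_right hWd
      (abs_nonneg (wd k))).trans_eq (hγdot _)) (norm_absHistory_le φ ψ)
  set Wc : ℝ := ∫ s in Ioi 0, vecL1 (wc s) with hWcdef
  set Wd : ℝ := ∑' k, vecL1 (wd (k + 1)) with hWddef
  set Bd : ℝ := γ * (Wc + Wd) + C * ‖(φ, ψ)‖ with hBd
  have hwi : ∀ k, IntervalIntegrable wc volume 0 (t (k + 1)) := fun k =>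
    hwl.intervalIntegrable_Ici le_rfl (ht.nonneg _)
  have hzi : ∀ k, IntervalIntegrable (S.zc hc wc x) volume 0 (t (k + 1)) := fun k =>
    hx.intervalIntegrable_zc hhc.le ht le_rfl (ht.nonneg _) (hwi k)
  have hzLi : ∀ k, IntervalIntegrable (fun s => vecL1 (S.zc hc wc x s)) volume 0 (t (k + 1)) :=
    fun k => intervalIntegrable_iff.2 (Integrable.vecL1 (intervalIntegrable_iff.1 (hzi k)))
  have hbound : ∀ k, (∫ s in (0 : ℝ)..(t (k + 1)), vecL1 (S.zc hc wc x s)) +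
      ∑ j ∈ Finset.range k, vecL1 (S.zd hd t ψ wd x (j + 1)) ≤ Bd := by
    intro k
    have h := hacc k
    simp only [zero_mul, add_zero] at h
    have h1 : ∫ s in (0 : ℝ)..(t (k + 1)), vecL1 (S.zc hc wc x s) ≤
        ∫ s in (0 : ℝ)..(t (k + 1)), 1 ⬝ᵥ S.zc hc |wc| X s := by
      refine intervalIntegral.integral_mono_on_of_le_Ioo (ht.nonneg _) (hzLi k) ?_ fun s hs =>
        vecL1_le_of_abs_le (hzc s hs.1)
      exact (hX.intervalIntegrable_zc hhc.le ht le_rfl (ht.nonneg _)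
        (hwl'.intervalIntegrable_Ici le_rfl (ht.nonneg _))).dotProduct 1
    have h2 : ∑ j ∈ Finset.range k, vecL1 (S.zd hd t ψ wd x (j + 1)) ≤
        ∑ j ∈ Finset.range k, 1 ⬝ᵥ S.zd hd t |ψ| |wd| X (j + 1) :=
      Finset.sum_le_sum fun j _ => vecL1_le_of_abs_le (hzd _ (Nat.le_add_left 1 j))
    have h3 : ∫ s in (0 : ℝ)..(t (k + 1)), 1 ⬝ᵥ |wc| s ≤ Wc := by
      rw [intervalIntegral.integral_of_le (ht.nonneg _)]
      have e : (fun s => 1 ⬝ᵥ |wc| s) = fun s => vecL1 (wc s) :=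
        funext fun s => (vecL1_eq_one_dotProduct_abs _).symm
      rw [e]
      exact setIntegral_mono_set (Integrable.vecL1 hwc)
        (Eventually.of_forall fun s => vecL1_nonneg _) Ioc_subset_Ioi_self.eventuallyLE
    have h4 : ∑ j ∈ Finset.range k, 1 ⬝ᵥ |wd| (j + 1) ≤ Wd := by
      refine le_trans (le_of_eq ?_)
        (hwd.sum_le_tsum (Finset.range k) fun j _ => vecL1_nonneg _)
      exact Finset.sum_congr rfl fun j _ => (vecL1_eq_one_dotProduct_abs _).symm
    have h5 := mul_le_mul_of_nonneg_left (add_le_add h3 h4) hγ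
    linarith
  have htt : Tendsto (fun k => t (k + 1)) atTop atTop := ht.tendsto.comp (tendsto_add_atTop_nat 1)
  have hIc0 : ∀ k, 0 ≤ ∫ s in (0 : ℝ)..(t (k + 1)), vecL1 (S.zc hc wc x s) := fun k =>
    intervalIntegral.integral_nonneg (ht.nonneg _) fun s _ => vecL1_nonneg _
  have hId0 : ∀ k, 0 ≤ ∑ j ∈ Finset.range k, vecL1 (S.zd hd t ψ wd x (j + 1)) := fun k =>
    Finset.sum_nonneg fun j _ => vecL1_nonneg _
  have hzint : IntegrableOn (S.zc hc wc x) (Ioi 0) := by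
    refine integrableOn_Ioi_of_intervalIntegral_norm_bounded Bd 0
      (fun k => (hzi k).1) htt (Eventually.of_forall fun k => ?_)
    refine le_trans ?_ ((le_add_of_nonneg_right (hId0 k)).trans (hbound k))
    exact intervalIntegral.integral_mono_on (ht.nonneg _) (hzi k).norm (hzLi k)
      fun s _ => norm_le_vecL1 _
  have hzsum : Summable fun k => vecL1 (S.zd hd t ψ wd x (k + 1)) :=
    summable_of_sum_range_le (fun k => vecL1_nonneg _) fun k =>
      (le_add_of_nonneg_left (hIc0 k)).trans (hbound k)
  refine ⟨hzint, hzsum, ?_⟩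
  have hlim := (intervalIntegral_tendsto_integral_Ioi 0 (Integrable.vecL1 hzint) htt).add
    hzsum.hasSum.tendsto_sum_nat
  have h := le_of_tendsto' hlim hbound
  have := norm_nonneg (φ, ψ)
  linarith

/-- Along unforced solutions a certificate with positive slack bounds the accumulated state,
both over time and over the impulses. -/
theorem IsCertificate.exists_accumulated_state_le (hcert : S.IsCertificate Tbar p p' μ c)
    (hpos : S.InternallyPositive) (hT : 0 ≤ Tbar) (hc0 : 0 < c) {hc : ℝ} (hhc : 0 < hc)
    (hd : ℕ) :
    ∃ C, 0 ≤ C ∧ ∀ t : ℕ → ℝ, IsImpulseSequence t → HasMinDwellTime Tbar t →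
      ∀ (φ : C(Icc (-hc) (0 : ℝ), Fin n → ℝ)) (ψ : Fin hd → Fin n → ℝ) (x : ℝ → Fin n → ℝ),
      S.IsSolution hc hd t φ ψ 0 0 x → ∀ k,
        (∫ s in (-hc)..(t (k + 1)), ‖x s‖) ≤ C * ‖(φ, ψ)‖ ∧
        ∑ j ∈ Finset.range k, ‖x (t (j + 1))‖ ≤ C * ‖(φ, ψ)‖ := by
  set C₀ : ℝ := vecL1 (p 0) + hc * vecL1 μ + hd * vecL1 (p 0 ᵥ* S.Gd + 1 ᵥ* S.Hd) with hC₀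
  have hC0 : 0 ≤ C₀ := by
    have := vecL1_nonneg (p 0)
    have := vecL1_nonneg μ
    have := vecL1_nonneg (p 0 ᵥ* S.Gd + 1 ᵥ* S.Hd)
    positivity
  refine ⟨hc + C₀ / c, by positivity, fun t ht hdwell φ ψ x hx k => ?_⟩
  have hw0 : LocallyIntegrableOn (0 : ℝ → Fin pc → ℝ) (Ici 0) := locallyIntegrableOn_const 0
  obtain ⟨X, hX, hxX, hzc, hzd⟩ := hpos.exists_majorant hhc ht hw0 hx
  rw [abs_zero, abs_zero] at hX
  rw [abs_zero] at hzc hzd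
  have hX0 : ∀ s, -hc ≤ s → 0 ≤ X s := fun s hs => (abs_nonneg (x s)).trans (hxX s hs)
  have hacc := hX.accumulated_le (N := ‖(φ, ψ)‖) (γ := 0) hhc.le ht hX0
    (fun j => abs_nonneg (ψ j)) hT hdwell hcert hw0 (fun τ s _ _ => by simp) (fun k _ => by simp)
    (norm_absHistory_le φ ψ) k
  rw [zero_mul, add_zero] at hacc
  have htk := ht.nonneg (k + 1)
  have hN := norm_nonneg (φ, ψ)
  have hxle : ∀ s, -hc ≤ s → ‖x s‖ ≤ 1 ⬝ᵥ X s := fun s hs =>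
    (norm_le_vecL1 _).trans (vecL1_le_of_abs_le (hxX s hs))
  have hXi : IntervalIntegrable (fun s => 1 ⬝ᵥ X s) volume 0 (t (k + 1)) :=
    (hX.intervalIntegrable hhc.le ht (by linarith) (by linarith)).dotProduct 1
  have hxi : ∀ a b, -hc ≤ a → -hc ≤ b → IntervalIntegrable (fun s => ‖x s‖) volume a b :=
    fun a b ha hb => (hx.intervalIntegrable hhc.le ht ha hb).norm
  have h1 : c * ∫ s in (0 : ℝ)..(t (k + 1)), ‖x s‖ ≤
      ∫ s in (0 : ℝ)..(t (k + 1)), (1 ⬝ᵥ S.zc hc 0 X s + c * (1 ⬝ᵥ X s)) := by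
    rw [← intervalIntegral.integral_const_mul]
    refine intervalIntegral.integral_mono_on_of_le_Ioo htk
      ((hxi _ _ (by linarith) (by linarith)).const_mul c) ?_ fun s hs => ?_
    · exact ((hX.intervalIntegrable_zc hhc.le ht le_rfl htk
        (hw0.intervalIntegrable_Ici le_rfl htk)).dotProduct 1).add (hXi.const_mul c)
    · have h2 : 0 ≤ 1 ⬝ᵥ S.zc hc 0 X s := dotProduct_nonneg_of_nonneg zero_le_one
        ((abs_nonneg _).trans (hzc s hs.1))
      have h3 := mul_le_mul_of_nonneg_left (hxle s (by linarith [hs.1])) hc0.le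
      linarith
  have h2 : c * ∑ j ∈ Finset.range k, ‖x (t (j + 1))‖ ≤ ∑ j ∈ Finset.range k,
      (1 ⬝ᵥ S.zd hd t |ψ| 0 X (j + 1) + c * (1 ⬝ᵥ X (t (j + 1)))) := by
    rw [Finset.mul_sum]
    refine Finset.sum_le_sum fun j _ => ?_
    have h2 : 0 ≤ 1 ⬝ᵥ S.zd hd t |ψ| 0 X (j + 1) := dotProduct_nonneg_of_nonneg zero_le_one
      ((abs_nonneg _).trans (hzd (j + 1) (Nat.le_add_left 1 j)))
    have h3 := mul_le_mul_of_nonneg_left (hxle (t (j + 1)) (by linarith [ht.nonneg (j + 1)]))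
      hc0.le
    linarith
  have h3 : 0 ≤ ∫ s in (0 : ℝ)..(t (k + 1)), ‖x s‖ :=
    intervalIntegral.integral_nonneg htk fun s _ => norm_nonneg _
  have h4 : 0 ≤ ∑ j ∈ Finset.range k, ‖x (t (j + 1))‖ :=
    Finset.sum_nonneg fun j _ => norm_nonneg _
  have h5 : ∫ s in (-hc)..0, ‖x s‖ ≤ hc * ‖(φ, ψ)‖ := by
    refine (intervalIntegral.integral_mono_on (g := fun _ => ‖(φ, ψ)‖) (by linarith)
      (hxi _ _ le_rfl (by linarith)) intervalIntegrable_const fun s hs => ?_).trans_eq ?_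
    · have := hx.history ⟨s, hs⟩
      rw [this]
      exact (φ.norm_coe_le_norm _).trans (norm_fst_le (φ, ψ))
    · rw [intervalIntegral.integral_const, smul_eq_mul, zero_sub, neg_neg]
  have h6 := intervalIntegral.integral_add_adjacent_intervals
    (hxi (-hc) 0 le_rfl (by linarith)) (hxi 0 (t (k + 1)) (by linarith) (by linarith))
  have h7 : ∀ y, c * y ≤ C₀ * ‖(φ, ψ)‖ → y ≤ C₀ / c * ‖(φ, ψ)‖ := fun y hy => by
    rw [div_mul_eq_mul_div, le_div_iff₀ hc0]; linarith
  have h8 := mul_nonneg hc0.le h3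
  have h9 := mul_nonneg hc0.le h4
  refine ⟨?_, ?_⟩
  · have := h7 (∫ s in (0 : ℝ)..(t (k + 1)), ‖x s‖) (by linarith)
    rw [← h6]
    linarith
  · have := h7 (∑ j ∈ Finset.range k, ‖x (t (j + 1))‖) (by linarith)
    have := mul_nonneg hhc.le hN
    linarith

/-- Within a dwell interval an unforced solution is controlled by the samples entering the last
jump and by its integral over the interval and the preceding delay window. -/
theorem exists_norm_le_samples_add_integral (S : ImpulsiveDelaySystem n pc pd qc qd)
    (hT : 0 ≤ Tbar) (hA : ∀ τ, Tbar ≤ τ → S.A τ = S.A Tbar)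
    (hG : ∀ τ, Tbar ≤ τ → S.Gc τ = S.Gc Tbar) {hc : ℝ} (hhc : 0 < hc) (hd : ℕ) :
    ∃ C, 0 ≤ C ∧ ∀ t : ℕ → ℝ, IsImpulseSequence t →
      ∀ (φ : C(Icc (-hc) (0 : ℝ), Fin n → ℝ)) (ψ : Fin hd → Fin n → ℝ) (x : ℝ → Fin n → ℝ),
      S.IsSolution hc hd t φ ψ 0 0 x → ∀ k, ∀ s ∈ Ioc (t k) (t (k + 1)),
        ‖x s‖ ≤ C * (‖x (t k)‖ + ‖delayedSample hd t ψ x k‖ +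
          ∫ r in (t k - hc)..(t (k + 1)), ‖x r‖) := by
  have hbd : ∀ M : ℝ → Matrix (Fin n) (Fin n) ℝ, ContinuousOn M (Ici 0) →
      (∀ τ, Tbar ≤ τ → M τ = M Tbar) → ∃ K, 0 ≤ K ∧ ∀ τ, 0 ≤ τ → ∀ v, ‖M τ *ᵥ v‖ ≤ K * ‖v‖ := by
    intro M hM hconst
    obtain ⟨K, hK0, hK⟩ := exists_norm_mulVec_le (hM.mono (Icc_subset_Ici_self : Icc 0 Tbar ⊆ _))
    refine ⟨K, hK0, fun τ hτ v => ?_⟩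
    rcases le_total τ Tbar with h | h
    · exact hK τ ⟨hτ, h⟩ v
    · rw [hconst τ h]; exact hK Tbar ⟨hT, le_rfl⟩ v
  obtain ⟨K₁, hK₁, hA'⟩ := hbd S.A S.continuousOn_A hA
  obtain ⟨K₂, hK₂, hG'⟩ := hbd S.Gc S.continuousOn_Gc hG
  obtain ⟨K₃, hK₃, hJ⟩ := hbd (fun _ => S.J) continuousOn_const fun _ _ => rfl
  obtain ⟨K₄, hK₄, hGd⟩ := hbd (fun _ => S.Gd) continuousOn_const fun _ _ => rfl
  refine ⟨1 + K₁ + K₂ + K₃ + K₄, by positivity, fun t ht φ ψ x hx k s hs => ?_⟩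
  have htk := ht.nonneg k
  set I : ℝ := ∫ r in (t k - hc)..(t (k + 1)), ‖x r‖ with hI
  have hxi : ∀ a b, -hc ≤ a → -hc ≤ b → IntervalIntegrable (fun s => ‖x s‖) volume a b :=
    fun a b ha hb => (hx.intervalIntegrable hhc.le ht ha hb).norm
  have hsub : ∀ a b, t k - hc ≤ a → a ≤ b → b ≤ t (k + 1) → ∫ r in a..b, ‖x r‖ ≤ I :=
    fun a b ha hab hb => intervalIntegral.integral_mono_interval ha hab hb
      (Eventually.of_forall fun r => norm_nonneg _)
      (hxi _ _ (by linarith) (by linarith [ht.nonneg (k + 1)]))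
  have hI0 : 0 ≤ I := intervalIntegral.integral_nonneg (by linarith [ht.lt_succ k])
    fun r _ => norm_nonneg _
  have hpj : ‖S.postJump hd t ψ 0 x k‖ ≤
      (1 + K₃ + K₄) * (‖x (t k)‖ + ‖delayedSample hd t ψ x k‖) := by
    have n1 := norm_nonneg (x (t k))
    have n2 := norm_nonneg (delayedSample hd t ψ x k)
    unfold postJump
    split_ifs with h
    · subst h
      rw [ht.zero] at n1 ⊢
      nlinarith [mul_nonneg (add_nonneg hK₃ hK₄) (add_nonneg n1 n2)]
    · rw [Pi.zero_apply, Matrix.mulVec_zero, add_zero]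
      have h1 := hJ 0 le_rfl (x (t k))
      have h2 := hGd 0 le_rfl (delayedSample hd t ψ x k)
      refine (norm_add_le _ _).trans ((add_le_add h1 h2).trans ?_)
      nlinarith [mul_nonneg hK₃ n2, mul_nonneg hK₄ n1]
  have hfl : ‖∫ r in (0 : ℝ)..(s - t k), S.flowField hc (t k) 0 x r‖ ≤ K₁ * I + K₂ * I := by
    have hs0 : 0 ≤ s - t k := sub_nonneg.2 hs.1.le
    have i1 : IntervalIntegrable (fun r => ‖x (t k + r)‖) volume 0 (s - t k) := by
      simpa using (hxi (t k + 0) (t k + (s - t k)) (by linarith) (by linarith)).comp_add_left (t k)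
    have i2 : IntervalIntegrable (fun r => ‖x (t k + r - hc)‖) volume 0 (s - t k) := by
      have := (hxi (t k - hc + 0) (t k - hc + (s - t k)) (by linarith)
        (by linarith)).comp_add_left (t k - hc)
      simpa [add_sub_right_comm] using this
    have e1 : ∫ r in (0 : ℝ)..(s - t k), ‖x (t k + r)‖ ≤ I := by
      rw [intervalIntegral.integral_comp_add_left (fun r => ‖x r‖)]
      exact hsub _ _ (by linarith) (by linarith) (by linarith [hs.2])
    have e2 : ∫ r in (0 : ℝ)..(s - t k), ‖x (t k + r - hc)‖ ≤ I := by
      simp only [add_sub_right_comm (t k)]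
      rw [intervalIntegral.integral_comp_add_left (fun r => ‖x r‖)]
      exact hsub _ _ (by linarith) (by linarith) (by linarith [hs.2])
    refine (intervalIntegral.norm_integral_le_of_norm_le (g := fun r =>
      K₁ * ‖x (t k + r)‖ + K₂ * ‖x (t k + r - hc)‖) hs0 ?_
      ((i1.const_mul K₁).add (i2.const_mul K₂))).trans ?_
    · filter_upwards with r hr
      simp only [flowField, Pi.zero_apply, Matrix.mulVec_zero, add_zero]
      exact (norm_add_le _ _).trans (add_le_add (hA' r hr.1.le _) (hG' r hr.1.le _))
    · rw [intervalIntegral.integral_add (i1.const_mul K₁) (i2.const_mul K₂),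
        intervalIntegral.integral_const_mul, intervalIntegral.integral_const_mul]
      exact add_le_add (mul_le_mul_of_nonneg_left e1 hK₁) (mul_le_mul_of_nonneg_left e2 hK₂)
  rw [hx.eq_flowCurve hs]
  refine (norm_add_le _ _).trans ((add_le_add hpj hfl).trans ?_)
  have n1 := norm_nonneg (x (t k))
  have n2 := norm_nonneg (delayedSample hd t ψ x k)
  nlinarith [mul_nonneg (add_nonneg hK₁ hK₂) (add_nonneg n1 n2),
    mul_nonneg (add_nonneg hK₃ hK₄) hI0]

/-- A certificate with positive slack yields asymptotic stability: the accumulated state is finite and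
proportional to the initial data, and it controls the state pointwise. -/
theorem IsCertificate.asymptoticallyStable (hcert : S.IsCertificate Tbar p p' μ c)
    (hpos : S.InternallyPositive) (hT : 0 ≤ Tbar) (hc0 : 0 < c)
    (hA : ∀ τ, Tbar ≤ τ → S.A τ = S.A Tbar) (hG : ∀ τ, Tbar ≤ τ → S.Gc τ = S.Gc Tbar)
    {hc : ℝ} (hhc : 0 < hc) (hd : ℕ) : S.AsymptoticallyStable hc hd Tbar := by
  obtain ⟨C, hC, hacc⟩ := hcert.exists_accumulated_state_le hpos hT hc0 hhc hd
  obtain ⟨D, hD, hflow⟩ := S.exists_norm_le_samples_add_integral hT hA hG hhc hd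
  refine ⟨fun ε hε => ?_, ?_⟩
  · set B : ℝ := D * ((1 + C) + (1 + C) + C) + 1 with hB
    have hB0 : 0 < B := by positivity
    refine ⟨ε / B, by positivity, fun t ht hdwell φ ψ x hx hN s hs => ?_⟩
    have hacc' := hacc t ht hdwell φ ψ x hx
    rw [lt_div_iff₀ hB0] at hN
    set N := ‖(φ, ψ)‖
    have hN0 : 0 ≤ N := norm_nonneg _
    have hφ : ∀ s ∈ Icc (-hc) 0, ‖x s‖ ≤ N := fun s hs => by
      have := hx.history ⟨s, hs⟩
      rw [this]
      exact (φ.norm_coe_le_norm _).trans (norm_fst_le (φ, ψ))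
    have hxk : ∀ k, ‖x (t k)‖ ≤ (1 + C) * N := by
      rintro (_ | k)
      · rw [ht.zero]
        have := hφ 0 ⟨by linarith, le_rfl⟩
        nlinarith [mul_nonneg hC hN0]
      · have h1 := (hacc' (k + 1)).2
        have h2 := Finset.single_le_sum (f := fun j => ‖x (t (j + 1))‖)
          (fun j _ => norm_nonneg _) (Finset.self_mem_range_succ k)
        linarith
    have hsample : ∀ k, ‖delayedSample hd t ψ x k‖ ≤ (1 + C) * N := by
      intro k
      unfold delayedSample
      split_ifs
      · have := (norm_le_pi_norm ψ ⟨k, ‹_›⟩).trans (norm_snd_le (φ, ψ))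
        nlinarith [mul_nonneg hC hN0]
      · exact hxk _
    rcases hs.eq_or_lt with rfl | hs
    · have := hxk 0
      rw [ht.zero] at this
      have := hφ 0 ⟨by linarith, le_rfl⟩
      have : 0 ≤ D * ((1 + C) + (1 + C) + C) := by positivity
      nlinarith
    · obtain ⟨k, -, hk⟩ := ht.exists_mem_Ioc (m := 0) (ht.zero.symm ▸ hs)
      have h1 := hflow t ht φ ψ x hx k s hk
      have h2 : ∫ r in (t k - hc)..(t (k + 1)), ‖x r‖ ≤ C * N := by
        refine le_trans ?_ (hacc' k).1
        exact intervalIntegral.integral_mono_interval (by linarith [ht.nonneg k])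
          (by linarith [ht.lt_succ k]) le_rfl (Eventually.of_forall fun r => norm_nonneg _)
          (hx.intervalIntegrable hhc.le ht le_rfl (by linarith [ht.nonneg (k + 1)])).norm
      have h3 := mul_le_mul_of_nonneg_left (add_le_add (add_le_add (hxk k) (hsample k)) h2) hD
      calc ‖x s‖ ≤ D * ((1 + C) * N + (1 + C) * N + C * N) := h1.trans h3
        _ ≤ N * B := by rw [hB]; linarith
        _ < ε := hN
  · intro t ht hdwell φ ψ x hx
    have hacc' := hacc t ht hdwell φ ψ x hx
    have htt : Tendsto (fun k => t (k + 1)) atTop atTop :=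
      ht.tendsto.comp (tendsto_add_atTop_nat 1)
    have hxi : ∀ a b, -hc ≤ a → -hc ≤ b → IntervalIntegrable (fun s => ‖x s‖) volume a b :=
      fun a b ha hb => (hx.intervalIntegrable hhc.le ht ha hb).norm
    have hxk : Tendsto (fun k => ‖x (t k)‖) atTop (𝓝 0) :=
      (tendsto_add_atTop_iff_nat 1).1 (summable_of_sum_range_le (fun k => norm_nonneg _)
        fun k => (hacc' k).2).tendsto_atTop_zero
    have hsample : Tendsto (fun k => ‖delayedSample hd t ψ x k‖) atTop (𝓝 0) := by
      refine (hxk.comp (tendsto_sub_atTop_nat hd)).congr' ?_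
      filter_upwards [eventually_ge_atTop hd] with k hk
      simp [delayedSample, not_lt.2 hk]
    have hint : IntegrableOn (fun s => ‖x s‖) (Ioi (-hc)) := by
      refine integrableOn_Ioi_of_intervalIntegral_norm_bounded (C * ‖(φ, ψ)‖) (-hc)
        (fun k => (hxi _ _ le_rfl (by linarith [ht.nonneg (k + 1)])).1) htt
        (Eventually.of_forall fun k => ?_)
      simpa using (hacc' k).1
    have hwin : Tendsto (fun k => ∫ r in (t k - hc)..(t (k + 1)), ‖x r‖) atTop (𝓝 0) := by
      have h1 := intervalIntegral_tendsto_integral_Ioi (-hc) hint htt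
      have h2 := intervalIntegral_tendsto_integral_Ioi (-hc) hint
        (tendsto_atTop_add_const_right atTop (-hc) ht.tendsto)
      have h3 := h1.sub h2
      rw [sub_self] at h3
      refine h3.congr fun k => ?_
      have := intervalIntegral.integral_add_adjacent_intervals
        (hxi (-hc) (t k - hc) le_rfl (by linarith [ht.nonneg k]))
        (hxi (t k - hc) (t (k + 1)) (by linarith [ht.nonneg k]) (by linarith [ht.nonneg (k + 1)]))
      rw [← sub_eq_add_neg, ← this, add_sub_cancel_left]
    have hβ := ((hxk.add hsample).add hwin).const_mul D
    rw [add_zero, add_zero, mul_zero] at hβ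
    rw [tendsto_zero_iff_norm_tendsto_zero, Metric.tendsto_atTop]
    intro ε hε
    obtain ⟨m, hm⟩ := eventually_atTop.1 (hβ.eventually (gt_mem_nhds hε))
    refine ⟨t m + 1, fun s hs => ?_⟩
    obtain ⟨k, hmk, hk⟩ := ht.exists_mem_Ioc (m := m) (s := s) (by linarith)
    rw [Real.dist_eq, sub_zero, abs_of_nonneg (norm_nonneg _)]
    exact (hflow t ht φ ψ x hx k s hk).trans_lt (hm k hmk)

end ImpulsiveDelaySystem

theorem mainTheorem6 {n pc pd qc qd : ℕ} (S : ImpulsiveDelaySystem n pc pd qc qd)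
    (hpos : S.InternallyPositive)
    (Tbar : ℝ) (hT : 0 < Tbar)
    (hA : ∀ τ, Tbar ≤ τ → S.A τ = S.A Tbar)
    (hG : ∀ τ, Tbar ≤ τ → S.Gc τ = S.Gc Tbar)
    (hE : ∀ τ, Tbar ≤ τ → S.Ec τ = S.Ec Tbar)
    (ζ ζ' : ℝ → Fin n → ℝ)
    (hζ : ∀ τ ∈ Icc 0 Tbar, HasDerivWithinAt ζ (ζ' τ) (Icc 0 Tbar) τ)
    (hζ0 : ∀ i, 0 < ζ 0 i) (hζT : ∀ i, 0 < ζ Tbar i)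
    (μc : Fin n → ℝ) (hμ : ∀ i, 0 < μc i)
    (ε γ : ℝ) (hε : 0 < ε) (hγ : 0 < γ)
    -- flow condition for timer values at least `Tbar`
    (h0x : ζ Tbar ᵥ* S.A Tbar + μc + 1 ᵥ* S.Cc ≤ fun _ => -ε)
    (h0h : ζ Tbar ᵥ* S.Gc Tbar - μc + 1 ᵥ* S.Hc ≤ 0)
    (h0w : ζ Tbar ᵥ* S.Ec Tbar + 1 ᵥ* S.Fc ≤ fun _ => γ)
    -- flow condition on `[0, Tbar]`
    (h1x : ∀ τ ∈ Icc 0 Tbar, ζ' τ + ζ τ ᵥ* S.A τ + μc + 1 ᵥ* S.Cc ≤ 0)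
    (h1h : ∀ τ ∈ Icc 0 Tbar, ζ τ ᵥ* S.Gc τ - μc + 1 ᵥ* S.Hc ≤ 0)
    (h1w : ∀ τ ∈ Icc 0 Tbar, ζ τ ᵥ* S.Ec τ + 1 ᵥ* S.Fc ≤ fun _ => γ)
    -- jump condition
    (h2x : -ζ Tbar + ζ 0 ᵥ* (S.J + S.Gd) + 1 ᵥ* (S.Cd + S.Hd) ≤ fun _ => -ε)
    (h2w : ζ 0 ᵥ* S.Ed + 1 ᵥ* S.Fd ≤ fun _ => γ) :
    ∀ (hc : ℝ) (hd : ℕ), 0 < hc →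
      S.AsymptoticallyStable hc hd Tbar ∧ S.HasHybridGain hc hd Tbar γ := by
  intro hc hd hhc
  have hT0 : (0 : ℝ) ≤ Tbar := hT.le
  have hTmem : Tbar ∈ Icc 0 Tbar := ⟨hT0, le_rfl⟩
  obtain ⟨hGd, hHd⟩ := hpos.nonneg_Gd_Hd
  have hcert : S.IsCertificate Tbar ζ ζ' μc 0 := by
    refine ⟨hζ, fun τ hτ => ?_, h1h, fun τ hτ => ?_, fun τ hτ => ?_, ?_, fun i => (hζT i).le,
      fun i => (hμ i).le, ?_⟩
    · rw [neg_zero]; exact h1x τ hτ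
    · rw [hA τ hτ]
      exact h0x.trans fun _ => by linarith
    · rw [hG τ hτ]
      exact h0h
    · exact h2x.trans fun _ => by linarith
    · refine add_nonneg ?_ ?_
      · exact fun i => dotProduct_nonneg_of_nonneg (fun j => (hζ0 j).le) fun j => hGd j i
      · exact fun i => dotProduct_nonneg_of_nonneg zero_le_one fun j => hHd j i
  obtain ⟨q, q', c, hc0, hq⟩ := hcert.exists_pos_slack hpos hε hT0 hA hG hζT h0x h2x
  refine ⟨hq.asymptoticallyStable hpos hT0 hc0 hA hG hhc hd,
    hcert.hasHybridGain hpos hT0 hγ.le (fun τ hτ => ?_) h2w hhc hd⟩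
  rcases le_total τ Tbar with h | h
  · rw [min_eq_left h]; exact h1w τ ⟨hτ, h⟩
  · rw [min_eq_right h, hE τ h]; exact h0w
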